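/- Theorem 1.2 (t.centered, centered entries). Let $\alpha>1$, let $p\ge 2$ be an integer, and let $\mu_1,\dots,\mu_p$ be fixed probability measures on $\mathbb{R}$, each with mean $0$ and variance $1$, such that $\mu_1,\dots,\mu_{p-1}$ have a finite moment of order $4\alpha$ and $\mu_p$ has a finite moment of order $2\alpha$. For all integers $n_0,\dots,n_p\ge 1$, let $A^{(q)}=(A^{(q)}_{ij})_{1\le i\le n_{q-1},\,1\le j\le n_q}$, $1\le q\le p$, be random matrices, defined on a probability space that may depend on $(n_0,\dots,n_p)$, such that all the entries of all the matrices are jointly independent and each entry of $A^{(q)}$ has law $\mu_q$. Let $P:=A^{(1)}\cdots A^{(p)}\in\mathbb{R}^{n_0\times n_p}$, and write $\|P\|_{\ell^\infty\to\ell^\infty}:=\sup_{|x|_\infty\le 1}|Px|_\infty$. Then $$n_p^{-1}(n_1\cdots n_{p-1})^{-\frac12}\,\|P\|_{\ell^\infty\to\ell^\infty}\longrightarrow\sqrt{\frac{2}{\pi}}$$ in probability as $n_0\asymp\cdots\asymp n_p\to\infty$, that is: for every $C<+\infty$ and $\varepsilon,\delta>0$ there exists $N\in\mathbb{N}$ such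 that, for all positive integers $n_0,\dots,n_p$ satisfying $N\le n_q\le C\,n_{q'}$ for all $q,q'\in\{0,\dots,p\}$, $$\mathbb{P}\left[\,\left|n_p^{-1}(n_1\cdots n_{p-1})^{-\frac12}\|P\|_{\ell^\infty\to\ell^\infty}-\sqrt{\tfrac{2}{\pi}}\right|\ge\varepsilon\right]\le\delta.$$ -/

import Mathlib

open MeasureTheory ProbabilityTheory

/-- The operator norm of a real matrix, seen as a linear map between `ℝⁿ` and `ℝᵐ` that both carry
the `ℓ^∞` norm (the norm of `Fin n → ℝ` is the supremum norm). -/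
noncomputable def linftyOpNorm {m n : ℕ} (A : Matrix (Fin m) (Fin n) ℝ) : ℝ :=
  ‖LinearMap.toContinuousLinearMap (Matrix.mulVecLin A)‖

/-- The product `A 0 * A 1 * ⋯ * A (p - 1)` of `p` matrices, where `A q` is of size
`n q × n (q + 1)`; the empty product is the identity matrix. -/
def chainProd : (p : ℕ) → (n : Fin (p + 1) → ℕ) →
    ((q : Fin p) → Matrix (Fin (n q.castSucc)) (Fin (n q.succ)) ℝ) →
    Matrix (Fin (n 0)) (Fin (n (Fin.last p))) ℝ
  | 0, n, _ => (1 : Matrix (Fin (n 0)) (Fin (n 0)) ℝ)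
  | p + 1, n, A =>
      chainProd p (fun q => n q.castSucc) (fun q => A q.castSucc) * A (Fin.last p)

/-- Convergence in probability of `U n` to `X n` as the dimensions `n 0, …, n p` go to infinity
while staying comparable. The probability space may depend on the dimensions. -/
def TendstoInProbComparable {p : ℕ} {Ω : (Fin (p + 1) → ℕ) → Type*}
    [∀ n, MeasurableSpace (Ω n)] (P : ∀ n, Measure (Ω n)) (U X : ∀ n, Ω n → ℝ) : Prop :=
  ∀ C ε δ : ℝ, 0 < ε → 0 < δ → ∃ N : ℕ, ∀ n : Fin (p + 1) → ℕ,
    (∀ q q', N ≤ n q ∧ (n q : ℝ) ≤ C * n q') →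
    (P n).real {ω | ε ≤ |U n ω - X n ω|} ≤ δ

/-! The norm is the largest `ℓ¹` norm of a row, and the maximum is attained at some row. So if the
normalized norm is `ε`-far from `√(2 / π)`, above or below, one normalized row is too. It suffices
to bound the deviation probability of a single row by a constant times `n ^ (-α)`: the union over
the `n 0` rows then costs `n ^ (1 - α) → 0`.

For one row, let `X` be the corresponding row of the product of all factors but the last, divided by
its typical Euclidean norm, and let `B` be the last factor. The quantity of interest is the average
over the columns `k` of `|∑ j, X j * B j k|`. Conditionally on `X` these are iid, and three facts
suffice. (a) The average is close to its conditional mean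
(`HasIIDColumns.lintegral_mean_abs_sub_rpow_le`). Moments of order `s = 2 * α` of the last law give
an error probability of order `n ^ (-s / 2) = n ^ (-α)`. (b) `∑ j, X j ^ 2` is close to `1`
(`lintegral_normRow_deviation_le`), by induction on the number of factors. Sums of squares now take
the place of sums of absolute values, hence moments of order `2 * s = 4 * α`. (c) No entry of `X` is
large (`measure_exists_le_abs_normRow_le`). Given (b) and (c), a central limit theorem uniform over
the weights (`exists_abs_integral_abs_weightedSumLaw_sub_le_of_near`) puts the conditional mean near
`E|N(0,1)| = √(2 / π)`.

All fluctuation bounds rest on the moment inequality `integral_abs_sum_rpow_le`. The central limit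
theorem uses the representation of `E|Y|` as an integral of `(1 - Re φ(t)) / t ^ 2`, with `φ` the
characteristic function. -/

/-! ### Second-order expansion of `|a + b| ^ r` with an explicit constant -/

/-- The constant of `abs_add_rpow_le`. -/
noncomputable def rpowTaylorConst (r : ℝ) : ℝ := 3 ^ r + 2 * r + r * (r - 1) * 2 ^ r

lemma rpowTaylorConst_nonneg {r : ℝ} (hr : 1 ≤ r) : 0 ≤ rpowTaylorConst r := by
  have : 0 ≤ r - 1 := by linarith
  unfold rpowTaylorConst; positivity

lemma one_le_rpowTaylorConst {r : ℝ} (hr : 1 ≤ r) : 1 ≤ rpowTaylorConst r := by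
  have : 0 ≤ r - 1 := by linarith
  have h3 : (1 : ℝ) ≤ 3 ^ r := Real.one_le_rpow (by norm_num) (by linarith)
  have : 0 ≤ r * (r - 1) * 2 ^ r := by positivity
  unfold rpowTaylorConst; linarith

/-- The graph of `u ↦ u ^ r` lies above its tangent line at `u`, evaluated at `1`. -/
lemma rpow_le_one_add_mul {r u : ℝ} (hr : 1 ≤ r) (hu : 0 < u) :
    u ^ r ≤ 1 + r * u ^ (r - 1) * (u - 1) := by
  -- Bernoulli's inequality at `u⁻¹`, to be multiplied by `u ^ r`.
  have h := one_add_mul_self_le_rpow_one_add (s := u⁻¹ - 1)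
    (by have := inv_pos.2 hu; linarith) hr
  rw [add_sub_cancel, Real.inv_rpow hu.le] at h
  have hp : 0 < u ^ r := Real.rpow_pos_of_pos hu r
  have h2 : u ^ r * (1 + r * (u⁻¹ - 1)) ≤ 1 := by
    calc _ ≤ u ^ r * (u ^ r)⁻¹ := by gcongr
      _ = 1 := mul_inv_cancel₀ hp.ne'
  rw [Real.rpow_sub_one hu.ne']
  field_simp at h2 ⊢
  nlinarith

/-- For `|t| ≥ 1/2` one has `|1 + t| ≤ 3 * |t|`, and a negative linear term is absorbed by `2 * r *
t ^ 2`. For `|t| ≤ 1/2` the tangent line at `1 + t` leaves the excess `r * ((1 + t) ^ (r - 1) - 1) *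
t`, which is quadratic in `t`. The three summands of `rpowTaylorConst` pay for these three bounds.
-/
lemma abs_one_add_rpow_le {r : ℝ} (hr : 2 ≤ r) (t : ℝ) :
    |1 + t| ^ r ≤ 1 + r * t + rpowTaylorConst r * (t ^ 2 + |t| ^ r) := by
  have h3 : (0 : ℝ) ≤ 3 ^ r := by positivity
  have hr1 : 0 ≤ r * (r - 1) * 2 ^ r := by
    have : 0 ≤ r - 1 := by linarith
    positivity
  have htr : 0 ≤ |t| ^ r := by positivity
  have ht2 : 0 ≤ t ^ 2 := by positivity
  rcases le_total (1 / 2) |t| with ht | ht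
  · have h1 : |1 + t| ^ r ≤ 3 ^ r * |t| ^ r := by
      rw [← Real.mul_rpow (by norm_num) (abs_nonneg t)]
      apply Real.rpow_le_rpow (abs_nonneg _) _ (by linarith)
      have := abs_add_le 1 t
      rw [abs_one] at this
      linarith
    have h2 : -(r * t) ≤ 2 * r * t ^ 2 := by
      have : -t ≤ 2 * t ^ 2 := by
        have := neg_abs_le t
        rw [← sq_abs]
        nlinarith
      nlinarith
    unfold rpowTaylorConst
    nlinarith [mul_nonneg h3 ht2, mul_nonneg hr1 htr, mul_nonneg hr1 ht2,
      mul_nonneg (by linarith : 0 ≤ r) htr]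
  · have hu := abs_le.1 ht
    have hu0 : 0 < 1 + t := by linarith
    have h1 := rpow_le_one_add_mul (by linarith : 1 ≤ r) hu0
    rw [add_sub_cancel_left] at h1
    have h2 : ((1 + t) ^ (r - 1) - 1) * t ≤ (r - 1) * 2 ^ r * t ^ 2 := by
      have h2r : (1 : ℝ) ≤ 2 ^ r := Real.one_le_rpow (by norm_num) (by linarith)
      rcases le_total 0 t with h0 | h0
      · have h := rpow_le_one_add_mul (by linarith : 1 ≤ r - 1) hu0
        rw [add_sub_cancel_left] at h
        have h4 : (1 + t) ^ (r - 1 - 1) ≤ 2 ^ r :=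
          (Real.rpow_le_rpow hu0.le (by linarith) (by linarith)).trans
            (Real.rpow_le_rpow_of_exponent_le (by norm_num) (by linarith))
        have h5 : (r - 1) * (1 + t) ^ (r - 1 - 1) * t ≤ (r - 1) * 2 ^ r * t := by
          have : 0 ≤ r - 1 := by linarith
          gcongr
        nlinarith
      · have h := one_add_mul_self_le_rpow_one_add (by linarith : -1 ≤ t)
          (by linarith : 1 ≤ r - 1)
        have h6 : (r - 1) * t ^ 2 ≤ (r - 1) * 2 ^ r * t ^ 2 := by
          have : 0 ≤ (r - 1) * t ^ 2 := mul_nonneg (by linarith) ht2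
          nlinarith
        nlinarith
    rw [abs_of_pos hu0]
    have h7 := mul_le_mul_of_nonneg_left h2 (by linarith : 0 ≤ r)
    unfold rpowTaylorConst
    nlinarith [mul_nonneg h3 ht2, mul_nonneg hr1 htr, mul_nonneg h3 htr,
      mul_nonneg (by linarith : 0 ≤ r) htr, mul_nonneg (by linarith : 0 ≤ r) ht2]

/-- By homogeneity, this is the previous bound at `t = b / a` times `|a| ^ r`. The term linear in
`b` is kept exact because it integrates to zero for independent centered `b`. -/
lemma abs_add_rpow_le {r : ℝ} (hr : 2 ≤ r) (a b : ℝ) :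
    |a + b| ^ r ≤ |a| ^ r + r * (|a| ^ (r - 2) * a) * b
      + rpowTaylorConst r * (|a| ^ (r - 2) * b ^ 2 + |b| ^ r) := by
  have hC := one_le_rpowTaylorConst (by linarith : 1 ≤ r)
  rcases eq_or_ne a 0 with rfl | ha
  · have : 0 ≤ |b| ^ r := by positivity
    have h0 : (0 : ℝ) ≤ |0| ^ (r - 2) * b ^ 2 := by positivity
    simp only [zero_add, abs_zero, mul_zero, zero_mul, add_zero,
      Real.zero_rpow (by linarith : r ≠ 0)]
    rw [abs_zero] at h0
    nlinarith
  · have h := mul_le_mul_of_nonneg_left (abs_one_add_rpow_le hr (b / a))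
      (by positivity : 0 ≤ |a| ^ r)
    have ha' : 0 < |a| := abs_pos.2 ha
    have e2 : |a| ^ r = |a| ^ (r - 2) * a ^ 2 := by
      rw [← sq_abs, ← Real.rpow_natCast, ← Real.rpow_add ha']; norm_num
    calc |a + b| ^ r = |a| ^ r * |1 + b / a| ^ r := by
          rw [← Real.mul_rpow (abs_nonneg _) (abs_nonneg _), ← abs_mul]; field_simp
      _ ≤ _ := h
      _ = _ := by
          rw [abs_div, Real.div_rpow (abs_nonneg _) (abs_nonneg _)]
          have : |a| ^ r ≠ 0 := by positivity
          have e3 : |a| ^ r * (r * (b / a)) = r * (|a| ^ (r - 2) * a) * b := by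
            rw [e2]; field_simp
          have e4 : |a| ^ r * ((b / a) ^ 2) = |a| ^ (r - 2) * b ^ 2 := by
            rw [e2]; field_simp
          have e5 : |a| ^ r * (|b| ^ r / |a| ^ r) = |b| ^ r := by field_simp
          linear_combination e3 + rpowTaylorConst r * e4 + rpowTaylorConst r * e5

/-- The constant of the moment inequality `integral_abs_sum_rpow_le`. -/
noncomputable def momentConst (r : ℝ) : ℝ := (4 * rpowTaylorConst r) ^ r

lemma one_le_momentConst {r : ℝ} (hr : 1 ≤ r) : 1 ≤ momentConst r := by
  have := one_le_rpowTaylorConst hr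
  exact Real.one_le_rpow (by linarith) (by linarith)

/-- This closes the induction for the moment inequality. With `C = rpowTaylorConst r` and `K = (4 *
C) ^ r`, both `C * K ^ ((r - 2) / r)` and `C` are at most `K / 4`, and each error term fits in the
growth of `s ^ (r / 2)` to `(s + d) ^ (r / 2)`. -/
lemma momentConst_step {r s d : ℝ} (hr : 2 ≤ r) (hs : 0 ≤ s) (hd : 0 ≤ d) :
    momentConst r * s ^ (r / 2)
      + rpowTaylorConst r * ((momentConst r * s ^ (r / 2)) ^ ((r - 2) / r) * d + d ^ (r / 2))
      ≤ momentConst r * (s + d) ^ (r / 2) := by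
  have hC := one_le_rpowTaylorConst (by linarith : 1 ≤ r)
  set C := rpowTaylorConst r
  have hKC : 4 * C ≤ momentConst r := by
    calc 4 * C = (4 * C) ^ (1 : ℝ) := (Real.rpow_one _).symm
      _ ≤ _ := Real.rpow_le_rpow_of_exponent_le (by linarith) (by linarith)
  have hK0 : 0 < momentConst r := by linarith
  have hKr : momentConst r ^ ((r - 2) / r) * (4 * C) ≤ momentConst r := by
    have e : momentConst r ^ ((r - 2) / r) = (4 * C) ^ (r - 2) := by
      unfold momentConst
      rw [← Real.rpow_mul (by linarith)]
      congr 1; field_simp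
    rw [e]
    calc (4 * C) ^ (r - 2) * (4 * C) = (4 * C) ^ (r - 1) := by
          rw [show r - 1 = (r - 2) + 1 by ring, Real.rpow_add_one (by linarith)]
      _ ≤ (4 * C) ^ r := Real.rpow_le_rpow_of_exponent_le (by linarith) (by linarith)
  have hr2 : 1 ≤ r / 2 := by linarith
  have h1 : s ^ (r / 2) + d ^ (r / 2) ≤ (s + d) ^ (r / 2) :=
    Real.add_rpow_le_rpow_add hs hd hr2
  have h2 : s ^ (r / 2) + s ^ ((r - 2) / 2) * d ≤ (s + d) ^ (r / 2) := by
    rcases hs.eq_or_lt with rfl | hs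
    · rcases eq_or_lt_of_le hr with rfl | hr'
      · simp
      · have h0 : (r - 2) / 2 ≠ 0 := by
          have : 0 < r - 2 := by linarith
          positivity
        rw [Real.zero_rpow h0, Real.zero_rpow (by linarith)]
        simp only [zero_mul, add_zero, zero_add]; positivity
    · have h := one_add_mul_self_le_rpow_one_add (s := d / s)
        (by have : 0 ≤ d / s := by positivity
            linarith) hr2
      have e : (s + d) ^ (r / 2) = s ^ (r / 2) * (1 + d / s) ^ (r / 2) := by
        rw [← Real.mul_rpow hs.le (by positivity)]; congr 1; field_simp
      have e2 : s ^ (r / 2) = s ^ ((r - 2) / 2) * s := by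
        rw [← Real.rpow_add_one hs.ne']; congr 1; ring
      rw [e]
      have h3 := mul_le_mul_of_nonneg_left h (by positivity : 0 ≤ s ^ (r / 2))
      refine le_trans ?_ h3
      have h4 : s ^ (r / 2) * (1 + r / 2 * (d / s)) = s ^ (r / 2) + r / 2 * (s ^ ((r - 2) / 2) * d) := by
        rw [e2]; field_simp
      rw [h4]
      have : 0 ≤ s ^ ((r - 2) / 2) * d := by positivity
      nlinarith
  have e3 : (momentConst r * s ^ (r / 2)) ^ ((r - 2) / r)
      = momentConst r ^ ((r - 2) / r) * s ^ ((r - 2) / 2) := by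
    rw [Real.mul_rpow hK0.le (by positivity), ← Real.rpow_mul hs]
    congr 2; field_simp
  rw [e3]
  have h5 : 0 ≤ s ^ ((r - 2) / 2) * d := by positivity
  have h6 : 0 ≤ d ^ (r / 2) := by positivity
  nlinarith [mul_le_mul_of_nonneg_right hKr h5, mul_le_mul_of_nonneg_right hKC h6]

/-! ### Moments of sums of independent centered variables -/

section Moments

variable {Ω : Type*} [MeasurableSpace Ω] {P : Measure Ω} [IsProbabilityMeasure P]

lemma MeasureTheory.MemLp.integrable_abs_rpow {f : Ω → ℝ} {r q : ℝ} (hf : MemLp f (ENNReal.ofReal r) P)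
    (hq : 0 ≤ q) (hqr : q ≤ r) : Integrable (fun ω => |f ω| ^ q) P := by
  rcases hq.eq_or_lt with rfl | hq
  · simp
  · have h := (hf.mono_exponent (ENNReal.ofReal_le_ofReal hqr)).integrable_norm_rpow
      (by simpa using hq) ENNReal.ofReal_ne_top
    simpa [ENNReal.toReal_ofReal hq.le] using h

/-- Monotonicity of the moments on a probability space. -/
lemma integral_abs_rpow_le {f : Ω → ℝ} {r q : ℝ} (hf : MemLp f (ENNReal.ofReal r) P)
    (hq : 0 ≤ q) (hqr : q ≤ r) : ∫ ω, |f ω| ^ q ∂P ≤ (∫ ω, |f ω| ^ r ∂P) ^ (q / r) := by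
  rcases hq.eq_or_lt with rfl | hq
  · simp
  have hr : 0 < r := hq.trans_le hqr
  have e : ∀ ω, (|f ω| ^ q) ^ (r / q) = |f ω| ^ r := fun ω => by
    rw [← Real.rpow_mul (abs_nonneg _)]; congr 1; field_simp
  have h := (convexOn_rpow ((one_le_div hq).2 hqr)).map_integral_le (μ := P)
    (f := fun ω => |f ω| ^ q)
    (Real.continuous_rpow_const (by positivity)).continuousOn isClosed_Ici
    (Filter.Eventually.of_forall fun ω => Real.rpow_nonneg (abs_nonneg _) _)
    (hf.integrable_abs_rpow hq.le hqr)
    (by simpa [Function.comp_def, e] using hf.integrable_abs_rpow hr.le le_rfl)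
  simp only [e] at h
  have h0 : 0 ≤ ∫ ω, |f ω| ^ q ∂P := integral_nonneg fun ω => by positivity
  calc ∫ ω, |f ω| ^ q ∂P = ((∫ ω, |f ω| ^ q ∂P) ^ (r / q)) ^ (q / r) := by
        rw [← Real.rpow_mul h0, div_mul_div_cancel₀ hq.ne', div_self hr.ne', Real.rpow_one]
    _ ≤ _ := Real.rpow_le_rpow (by positivity) h (by positivity)

/-- Integrate `abs_add_rpow_le`: independence and centering kill the linear term, the quadratic term
factors, and its two factors are controlled by the `r`-th moments. -/
lemma integral_abs_add_rpow_le {X Y : Ω → ℝ} {r s d : ℝ} (hr : 2 ≤ r) (hs : 0 ≤ s) (hd : 0 ≤ d)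
    (hX : MemLp X (ENNReal.ofReal r) P) (hY : MemLp Y (ENNReal.ofReal r) P)
    (hXY : IndepFun X Y P) (hY0 : ∫ ω, Y ω ∂P = 0)
    (hXs : ∫ ω, |X ω| ^ r ∂P ≤ momentConst r * s ^ (r / 2))
    (hYd : ∫ ω, |Y ω| ^ r ∂P ≤ d ^ (r / 2)) :
    ∫ ω, |X ω + Y ω| ^ r ∂P ≤ momentConst r * (s + d) ^ (r / 2) := by
  have hr0 : 0 < r := by linarith
  have hC := rpowTaylorConst_nonneg (by linarith : 1 ≤ r)
  have hK := one_le_momentConst (by linarith : 1 ≤ r)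
  have hYi : Integrable Y P := hY.integrable (by
    rw [← ENNReal.ofReal_one]; exact ENNReal.ofReal_le_ofReal (by linarith))
  have m1 : Measurable fun a : ℝ => |a| ^ (r - 2) * a := by fun_prop
  have m2 : Measurable fun a : ℝ => |a| ^ (r - 2) := by fun_prop
  have m3 : Measurable fun a : ℝ => a ^ 2 := by fun_prop
  have i1 : Integrable (fun ω => |X ω| ^ (r - 2) * X ω) P := by
    refine (hX.integrable_abs_rpow (by linarith : 0 ≤ r - 1) (by linarith)).mono'
      (m1.comp_aemeasurable hX.1.aemeasurable).aestronglyMeasurable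
      (Filter.Eventually.of_forall fun ω => ?_)
    rw [Real.norm_eq_abs, abs_mul, abs_of_nonneg (by positivity : 0 ≤ |X ω| ^ (r - 2))]
    rcases (abs_nonneg (X ω)).eq_or_lt with h | h
    · rw [← h]; simp [Real.rpow_nonneg]
    · rw [← Real.rpow_add_one h.ne', show r - 2 + 1 = r - 1 by ring]
  have i2 := hX.integrable_abs_rpow (by linarith : 0 ≤ r - 2) (by linarith)
  have i3 : Integrable (fun ω => (Y ω) ^ 2) P := by
    simpa using hY.integrable_abs_rpow (by norm_num : (0 : ℝ) ≤ 2) hr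
  have iXr := hX.integrable_abs_rpow hr0.le le_rfl
  have iYr := hY.integrable_abs_rpow hr0.le le_rfl
  have ind1 : IndepFun (fun ω => |X ω| ^ (r - 2) * X ω) Y P := hXY.comp m1 measurable_id
  have ind2 : IndepFun (fun ω => |X ω| ^ (r - 2)) (fun ω => (Y ω) ^ 2) P := hXY.comp m2 m3
  have j1 : Integrable (fun ω => |X ω| ^ (r - 2) * X ω * Y ω) P := ind1.integrable_mul i1 hYi
  have j2 : Integrable (fun ω => |X ω| ^ (r - 2) * (Y ω) ^ 2) P := ind2.integrable_mul i2 i3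
  have e1 : ∫ ω, |X ω| ^ (r - 2) * X ω * Y ω ∂P = 0 := by
    rw [ind1.integral_fun_mul_eq_mul_integral i1.1 hYi.1, hY0, mul_zero]
  have e2 : ∫ ω, |X ω| ^ (r - 2) * (Y ω) ^ 2 ∂P
      = (∫ ω, |X ω| ^ (r - 2) ∂P) * ∫ ω, (Y ω) ^ 2 ∂P :=
    ind2.integral_fun_mul_eq_mul_integral i2.1 i3.1
  have b1 : ∫ ω, |X ω| ^ (r - 2) ∂P ≤ (momentConst r * s ^ (r / 2)) ^ ((r - 2) / r) :=
    (integral_abs_rpow_le hX (by linarith) (by linarith)).trans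
      (Real.rpow_le_rpow (integral_nonneg fun ω => by positivity) hXs
        (div_nonneg (by linarith) hr0.le))
  have b2 : ∫ ω, (Y ω) ^ 2 ∂P ≤ d := by
    have h := (integral_abs_rpow_le hY (by norm_num : (0 : ℝ) ≤ 2) hr).trans
      (Real.rpow_le_rpow (integral_nonneg fun ω => by positivity) hYd (by positivity))
    rw [← Real.rpow_mul hd, show r / 2 * (2 / r) = 1 by field_simp, Real.rpow_one] at h
    simpa using h
  calc ∫ ω, |X ω + Y ω| ^ r ∂P
      ≤ ∫ ω, (|X ω| ^ r + r * (|X ω| ^ (r - 2) * X ω * Y ω)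
          + rpowTaylorConst r * (|X ω| ^ (r - 2) * (Y ω) ^ 2 + |Y ω| ^ r)) ∂P := by
        refine integral_mono ((hX.add hY).integrable_abs_rpow hr0.le le_rfl)
          ((iXr.add (j1.const_mul r)).add ((j2.add iYr).const_mul _)) fun ω => ?_
        simpa [mul_assoc] using abs_add_rpow_le hr (X ω) (Y ω)
    _ = ∫ ω, |X ω| ^ r ∂P + rpowTaylorConst r *
          ((∫ ω, |X ω| ^ (r - 2) ∂P) * (∫ ω, (Y ω) ^ 2 ∂P) + ∫ ω, |Y ω| ^ r ∂P) := by
        have h1 : Integrable (fun ω => |X ω| ^ r + r * (|X ω| ^ (r - 2) * X ω * Y ω)) P :=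
          iXr.add (j1.const_mul r)
        have h2 : Integrable (fun ω => rpowTaylorConst r *
          (|X ω| ^ (r - 2) * (Y ω) ^ 2 + |Y ω| ^ r)) P := (j2.add iYr).const_mul _
        rw [integral_add h1 h2, integral_add iXr (j1.const_mul r), integral_const_mul,
          integral_const_mul, integral_add j2 iYr, e1, e2]
        ring
    _ ≤ momentConst r * s ^ (r / 2) + rpowTaylorConst r *
          ((momentConst r * s ^ (r / 2)) ^ ((r - 2) / r) * d + d ^ (r / 2)) := by
        have h0 : 0 ≤ ∫ ω, (Y ω) ^ 2 ∂P := integral_nonneg fun ω => by positivity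
        gcongr
    _ ≤ _ := momentConst_step hr hs hd

/-- A moment inequality of Marcinkiewicz–Zygmund type for sums of independent centered
variables. -/
theorem integral_abs_sum_rpow_le {ι : Type*} (t : Finset ι) {Y : ι → Ω → ℝ} {x : ι → ℝ} {r : ℝ}
    (hr : 2 ≤ r) (hx : ∀ i, 0 ≤ x i) (hind : iIndepFun Y P) (hmeas : ∀ i, Measurable (Y i))
    (hY : ∀ i, MemLp (Y i) (ENNReal.ofReal r) P) (hY0 : ∀ i, ∫ ω, Y i ω ∂P = 0)
    (hYx : ∀ i, ∫ ω, |Y i ω| ^ r ∂P ≤ x i ^ r) :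
    ∫ ω, |∑ i ∈ t, Y i ω| ^ r ∂P ≤ momentConst r * (∑ i ∈ t, x i ^ 2) ^ (r / 2) := by
  classical
  induction t using Finset.induction_on with
  | empty => simp [Real.zero_rpow (by linarith : r ≠ 0), Real.zero_rpow (by linarith : r / 2 ≠ 0)]
  | insert j t hj ih =>
    have h := integral_abs_add_rpow_le hr (X := fun ω => ∑ i ∈ t, Y i ω) (Y := Y j)
      (Finset.sum_nonneg fun i _ => sq_nonneg (x i)) (sq_nonneg (x j))
      (memLp_finsetSum t fun i _ => hY i) (hY j)
      (by simpa [Finset.sum_fn] using hind.indepFun_finsetSum_of_notMem hmeas hj) (hY0 j) ih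
      (by rw [← Real.rpow_natCast, ← Real.rpow_mul (hx j)]
          convert hYx j using 2; push_cast; ring)
    simpa [Finset.sum_insert hj, add_comm] using h

end Moments

/-! ### First absolute moments through characteristic functions -/

section CharFun

/-- The integral of `(1 - cos u) / u ^ 2` over the positive half-line. -/
noncomputable def oneSubCosIntegral : ℝ := ∫ u in Set.Ioi (0 : ℝ), (1 - Real.cos u) / u ^ 2

lemma one_sub_cos_mul_div_nonneg (y t : ℝ) : 0 ≤ (1 - Real.cos (t * y)) / t ^ 2 :=
  div_nonneg (by linarith [Real.cos_le_one (t * y)]) (sq_nonneg t)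

/-- The bounds `1 - cos ≤ 2` (large `t`) and `1 - cos u ≤ u ^ 2 / 2` (small `t`) merge into a
product majorant, integrable in `t` and, under a second moment, in `y`. -/
lemma one_sub_cos_mul_div_le (y t : ℝ) :
    (1 - Real.cos (t * y)) / t ^ 2 ≤ (2 + y ^ 2 / 2) * (1 + t ^ 2)⁻¹ := by
  have h0 := one_sub_cos_mul_div_nonneg y t
  rw [← div_eq_mul_inv, le_div_iff₀ (by positivity), mul_add, mul_one]
  rcases eq_or_ne t 0 with rfl | ht
  · simp; positivity
  have h1 : (1 - Real.cos (t * y)) / t ^ 2 * t ^ 2 ≤ 2 := by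
    rw [div_mul_cancel₀ _ (by positivity)]
    linarith [Real.neg_one_le_cos (t * y)]
  have h2 : (1 - Real.cos (t * y)) / t ^ 2 ≤ y ^ 2 / 2 := by
    rw [div_le_iff₀ (by positivity)]
    have := Real.one_sub_sq_div_two_le_cos (x := t * y)
    linarith [mul_pow t y 2]
  linarith

lemma integrable_one_sub_cos_mul_div (y : ℝ) :
    Integrable fun t : ℝ => (1 - Real.cos (t * y)) / t ^ 2 := by
  refine (integrable_inv_one_add_sq.const_mul (2 + y ^ 2 / 2)).mono'
    (Measurable.aestronglyMeasurable (by fun_prop)) (Filter.Eventually.of_forall fun t => ?_)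
  rw [Real.norm_of_nonneg (one_sub_cos_mul_div_nonneg y t)]
  exact one_sub_cos_mul_div_le y t

/-- The value of the constant is never needed: it multiplies the moments of both laws being
compared, and positivity allows dividing by it. -/
lemma oneSubCosIntegral_pos : 0 < oneSubCosIntegral := by
  have hi : IntegrableOn (fun u : ℝ => (1 - Real.cos u) / u ^ 2) (Set.Ioi 0) := by
    simpa using (integrable_one_sub_cos_mul_div 1).integrableOn (s := Set.Ioi 0)
  have h0 : ∀ u : ℝ, 0 ≤ (1 - Real.cos u) / u ^ 2 := fun u => by
    simpa using one_sub_cos_mul_div_nonneg 1 u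
  rw [oneSubCosIntegral, setIntegral_pos_iff_support_of_nonneg_ae
    (Filter.Eventually.of_forall h0) hi]
  have hsub : Set.Ioo (0 : ℝ) 1 ⊆
      (Function.support fun u : ℝ => (1 - Real.cos u) / u ^ 2) ∩ Set.Ioi 0 := by
    intro u hu
    refine ⟨?_, hu.1⟩
    have hlt : Real.cos u < 1 := by
      have := Real.cos_lt_cos_of_nonneg_of_le_pi le_rfl
        (by linarith [Real.pi_gt_three, hu.2] : u ≤ Real.pi) hu.1
      simpa using this
    have : 0 < u := hu.1
    exact (div_pos (by linarith) (by positivity)).ne'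
  refine lt_of_lt_of_le ?_ (measure_mono hsub)
  simp

/-- Substitute `u = |y| * t`. -/
lemma integral_one_sub_cos_mul_div (y : ℝ) :
    ∫ t in Set.Ioi (0 : ℝ), (1 - Real.cos (t * y)) / t ^ 2 = oneSubCosIntegral * |y| := by
  rcases eq_or_ne y 0 with rfl | hy
  · simp
  have hy' : 0 < |y| := abs_pos.2 hy
  have h := integral_comp_mul_left_Ioi (fun u : ℝ => (1 - Real.cos u) / u ^ 2) 0 hy'
  rw [mul_zero, smul_eq_mul] at h
  have e : ∀ t : ℝ, (1 - Real.cos (t * y)) / t ^ 2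
      = y ^ 2 * ((1 - Real.cos (|y| * t)) / (|y| * t) ^ 2) := fun t => by
    rw [← Real.cos_abs (t * y), abs_mul, ← Real.cos_abs (|y| * t), abs_mul, abs_abs,
      mul_comm |t|, mul_pow, sq_abs]
    field_simp
  simp_rw [e]
  rw [integral_const_mul, h, ← oneSubCosIntegral, ← sq_abs]
  field_simp

/-- The first absolute moment in terms of the characteristic function. -/
lemma integral_one_sub_charFun_div (ρ : Measure ℝ) [IsProbabilityMeasure ρ]
    (hρ : Integrable (fun y : ℝ => y ^ 2) ρ) :
    (∫ t in Set.Ioi (0 : ℝ), (1 - (charFun ρ t).re) / t ^ 2) = oneSubCosIntegral * ∫ y, |y| ∂ρ ∧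
      ∀ t, (1 - (charFun ρ t).re) / t ^ 2 = ∫ y, (1 - Real.cos (t * y)) / t ^ 2 ∂ρ := by
  have hcos : ∀ t : ℝ, Integrable (fun y => Real.cos (t * y)) ρ := fun t =>
    (integrable_const (1 : ℝ)).mono' (by fun_prop)
      (Filter.Eventually.of_forall fun y => Real.abs_cos_le_one _)
  have h1 : ∀ t, (1 - (charFun ρ t).re) / t ^ 2 = ∫ y, (1 - Real.cos (t * y)) / t ^ 2 ∂ρ := by
    intro t
    have hre : (charFun ρ t).re = ∫ y, Real.cos (t * y) ∂ρ := by
      have hi : Integrable (fun y : ℝ => Complex.exp (t * y * Complex.I)) ρ :=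
        (integrable_const (1 : ℝ)).mono' (by fun_prop)
          (Filter.Eventually.of_forall fun y => by
            rw [← Complex.ofReal_mul, Complex.norm_exp_ofReal_mul_I])
      rw [charFun_apply_real]
      refine (integral_re hi).symm.trans (integral_congr_ae (Filter.Eventually.of_forall fun y => ?_))
      simp only [RCLike.re_to_complex]
      rw [← Complex.ofReal_mul, Complex.exp_ofReal_mul_I_re]
    rw [integral_div, integral_sub (integrable_const _) (hcos t), hre]
    simp
  refine ⟨?_, h1⟩
  simp_rw [h1]
  rw [integral_integral_swap, ← integral_const_mul]
  · simp_rw [integral_one_sub_cos_mul_div]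
  · have hb : Integrable (fun z : ℝ × ℝ => (1 + z.1 ^ 2)⁻¹ * (2 + z.2 ^ 2 / 2))
        ((volume.restrict (Set.Ioi 0)).prod ρ) :=
      (integrable_inv_one_add_sq.restrict (s := Set.Ioi 0)).mul_prod
        ((integrable_const 2).add (hρ.div_const 2))
    refine hb.mono' (Measurable.aestronglyMeasurable (by unfold Function.uncurry; fun_prop))
      (Filter.Eventually.of_forall fun z => ?_)
    rw [Function.uncurry, Real.norm_of_nonneg (one_sub_cos_mul_div_nonneg z.2 z.1)]
    exact (one_sub_cos_mul_div_le z.2 z.1).trans_eq (mul_comm _ _)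

/-- The majorant depends on the law only through its second moment, so tails in `t` are small
uniformly over all laws with second moment one. -/
lemma one_sub_charFun_div_mem (ρ : Measure ℝ) [IsProbabilityMeasure ρ]
    (hρ : ∫ y : ℝ, y ^ 2 ∂ρ = 1) (t : ℝ) :
    0 ≤ (1 - (charFun ρ t).re) / t ^ 2 ∧
      (1 - (charFun ρ t).re) / t ^ 2 ≤ 5 / 2 * (1 + t ^ 2)⁻¹ := by
  have hi : Integrable (fun y : ℝ => y ^ 2) ρ := .of_integral_ne_zero (by simp [hρ])
  rw [(integral_one_sub_charFun_div ρ hi).2]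
  refine ⟨integral_nonneg fun y => one_sub_cos_mul_div_nonneg y t, ?_⟩
  have hb : Integrable (fun y : ℝ => (2 + y ^ 2 / 2) * (1 + t ^ 2)⁻¹) ρ :=
    ((integrable_const 2).add (hi.div_const 2)).mul_const _
  calc _ ≤ ∫ y, (2 + y ^ 2 / 2) * (1 + t ^ 2)⁻¹ ∂ρ :=
        integral_mono (hb.mono' (by fun_prop) (Filter.Eventually.of_forall fun y => by
          rw [Real.norm_of_nonneg (one_sub_cos_mul_div_nonneg y t)]
          exact one_sub_cos_mul_div_le y t)) hb fun y => one_sub_cos_mul_div_le y t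
    _ = _ := by
        rw [integral_mul_const, integral_add (integrable_const _) (hi.div_const 2), integral_div,
          hρ]
        simp; norm_num

/-- Two centered laws of variance one whose characteristic functions are close near the origin have
close first absolute moments. -/
lemma exists_abs_integral_abs_sub_le {ε : ℝ} (hε : 0 < ε) :
    ∃ T > 0, ∃ δ > 0, ∀ (ρ σ : Measure ℝ) [IsProbabilityMeasure ρ] [IsProbabilityMeasure σ],
      ∫ y : ℝ, y ^ 2 ∂ρ = 1 → ∫ y : ℝ, y ^ 2 ∂σ = 1 →
      (∀ t ∈ Set.Ioc 0 T, ‖charFun ρ t - charFun σ t‖ ≤ δ * t ^ 2) →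
      |∫ y, |y| ∂ρ - ∫ y, |y| ∂σ| ≤ ε := by
  have hc := oneSubCosIntegral_pos
  -- `π / 2 - arctan T` is the integral of `(1 + t ^ 2)⁻¹` beyond `T`. Below `T` the factor `δ * t ^
  -- 2` cancels the denominator and contributes at most `δ * T`. With the `δ` chosen next, the total
  -- is at most `(1/6 + 5/12) * oneSubCosIntegral * ε`.
  obtain ⟨T, hT, hT0⟩ : ∃ T : ℝ, Real.pi / 2 - Real.arctan T ≤ oneSubCosIntegral * ε / 6 ∧ 0 < T := by
    have h : Filter.Tendsto (fun T => Real.pi / 2 - Real.arctan T) Filter.atTop (nhds 0) := by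
      simpa using (Real.tendsto_arctan_atTop.mono_right nhdsWithin_le_nhds).const_sub (Real.pi / 2)
    exact ((h.eventually_le_const (by positivity : 0 < oneSubCosIntegral * ε / 6)).and
      (Filter.eventually_gt_atTop 0)).exists
  refine ⟨T, hT0, oneSubCosIntegral * ε / (6 * T), by positivity, fun ρ σ _ _ hρ hσ h => ?_⟩
  set F := fun t : ℝ => (1 - (charFun ρ t).re) / t ^ 2
  set G := fun t : ℝ => (1 - (charFun σ t).re) / t ^ 2
  have hF := one_sub_charFun_div_mem ρ hρ
  have hG := one_sub_charFun_div_mem σ hσ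
  have hb : Integrable (fun t : ℝ => 5 / 2 * (1 + t ^ 2)⁻¹) :=
    integrable_inv_one_add_sq.const_mul _
  have hmF : Measurable F := by
    have := measurable_charFun (μ := ρ); fun_prop
  have hmG : Measurable G := by
    have := measurable_charFun (μ := σ); fun_prop
  have iF : Integrable F := hb.mono' hmF.aestronglyMeasurable
    (Filter.Eventually.of_forall fun t => by rw [Real.norm_of_nonneg (hF t).1]; exact (hF t).2)
  have iG : Integrable G := hb.mono' hmG.aestronglyMeasurable
    (Filter.Eventually.of_forall fun t => by rw [Real.norm_of_nonneg (hG t).1]; exact (hG t).2)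
  have e : oneSubCosIntegral * (∫ y, |y| ∂ρ - ∫ y, |y| ∂σ)
      = (∫ t in Set.Ioc 0 T, (F t - G t)) + ∫ t in Set.Ioi T, (F t - G t) := by
    rw [mul_sub, ← (integral_one_sub_charFun_div ρ (.of_integral_ne_zero (by simp [hρ]))).1,
      ← (integral_one_sub_charFun_div σ (.of_integral_ne_zero (by simp [hσ]))).1,
      ← integral_sub iF.restrict iG.restrict, ← Set.Ioc_union_Ioi_eq_Ioi hT0.le]
    exact setIntegral_union
      (Set.disjoint_left.2 fun t (h1 : t ∈ Set.Ioc 0 T) (h2 : t ∈ Set.Ioi T) => not_lt.2 h1.2 h2)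
      measurableSet_Ioi (iF.sub iG).integrableOn (iF.sub iG).integrableOn
  have b1 : ‖∫ t in Set.Ioc 0 T, (F t - G t)‖ ≤ oneSubCosIntegral * ε / 6 := by
    have := norm_setIntegral_le_of_norm_le_const (μ := volume) (s := Set.Ioc 0 T)
      (f := fun t => F t - G t) (C := oneSubCosIntegral * ε / (6 * T)) (by simp) (fun t ht => ?_)
    · refine this.trans_eq ?_
      rw [Real.volume_real_Ioc_of_le hT0.le, sub_zero]; field_simp
    · have h3 : F t - G t = ((charFun σ t - charFun ρ t).re) / t ^ 2 := by
        simp only [F, G, Complex.sub_re]; ring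
      have ht0 : 0 < t := ht.1
      rw [h3, Real.norm_eq_abs, abs_div, abs_of_nonneg (sq_nonneg t), div_le_iff₀ (by positivity)]
      exact (Complex.abs_re_le_norm _).trans (by rw [norm_sub_rev]; exact h t ht)
  have b2 : ‖∫ t in Set.Ioi T, (F t - G t)‖ ≤ 5 / 2 * (oneSubCosIntegral * ε / 6) := by
    calc _ ≤ ∫ t in Set.Ioi T, 5 / 2 * (1 + t ^ 2)⁻¹ :=
          norm_integral_le_of_norm_le hb.restrict (Filter.Eventually.of_forall fun t => by
            rw [Real.norm_eq_abs, abs_le]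
            constructor <;> linarith [(hF t).1, (hF t).2, (hG t).1, (hG t).2])
      _ ≤ _ := by
          rw [integral_const_mul, integral_Ioi_inv_one_add_sq]; gcongr
  have b3 : oneSubCosIntegral * |∫ y, |y| ∂ρ - ∫ y, |y| ∂σ| ≤ oneSubCosIntegral * ε := by
    rw [← abs_of_pos hc, ← abs_mul, abs_of_pos hc, e]
    have := norm_add_le (∫ t in Set.Ioc 0 T, (F t - G t)) (∫ t in Set.Ioi T, (F t - G t))
    rw [Real.norm_eq_abs] at this
    have : 0 < oneSubCosIntegral * ε := by positivity
    linarith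
  exact le_of_mul_le_mul_left b3 hc

end CharFun

/-! ### Moments of the standard Gaussian -/

section Gaussian

lemma integral_abs_gaussianReal : ∫ y, |y| ∂(gaussianReal 0 1) = √(2 / Real.pi) := by
  have h : ∫ x : ℝ in Set.Ioi 0, x * Real.exp (-(1 / 2) * x ^ 2) = 1 := by
    have := integral_mul_cexp_neg_mul_sq (b := 1 / 2) (by norm_num)
    have h2 : ∀ x : ℝ, (x : ℂ) * Complex.exp (-(1 / 2) * (x : ℂ) ^ 2)
        = ((x * Real.exp (-(1 / 2) * x ^ 2) : ℝ) : ℂ) := fun x => by push_cast; rfl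
    simp_rw [h2] at this
    rw [integral_complex_ofReal] at this
    rw [show (2 * (1 / 2 : ℂ))⁻¹ = ((1 : ℝ) : ℂ) by norm_num] at this
    exact_mod_cast this
  rw [integral_gaussianReal_eq_integral_smul one_ne_zero]
  have e : ∀ x : ℝ, gaussianPDFReal 0 1 x • |x|
      = (√(2 * Real.pi))⁻¹ * (|x| * Real.exp (-(1 / 2) * |x| ^ 2)) := fun x => by
    simp only [gaussianPDFReal, smul_eq_mul, sq_abs, NNReal.coe_one, sub_zero]
    ring_nf
  simp_rw [e]
  rw [integral_const_mul, integral_comp_abs (f := fun x => x * Real.exp (-(1 / 2) * x ^ 2)), h,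
    mul_one, Real.sqrt_mul (by norm_num), Real.sqrt_div (by norm_num)]
  have : √2 * √2 = 2 := Real.mul_self_sqrt (by norm_num)
  field_simp
  linarith

lemma integral_sq_gaussianReal : ∫ y : ℝ, y ^ 2 ∂(gaussianReal 0 1) = 1 := by
  have h := variance_id_gaussianReal (μ := 0) (v := 1)
  rw [variance_eq_integral aemeasurable_id] at h
  simpa using h

end Gaussian

/-! ### A central limit theorem uniform over the weights -/

lemma norm_prod_sub_prod_le {ι : Type*} (s : Finset ι) {z w : ι → ℂ} (hz : ∀ i, ‖z i‖ ≤ 1)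
    (hw : ∀ i, ‖w i‖ ≤ 1) : ‖∏ i ∈ s, z i - ∏ i ∈ s, w i‖ ≤ ∑ i ∈ s, ‖z i - w i‖ := by
  classical
  induction s using Finset.induction_on with
  | empty => simp
  | insert j s hj ih =>
    rw [Finset.prod_insert hj, Finset.prod_insert hj, Finset.sum_insert hj]
    have hzs : ‖∏ i ∈ s, z i‖ ≤ 1 := by
      rw [norm_prod]
      exact Finset.prod_le_one (fun i _ => norm_nonneg _) fun i _ => hz i
    calc ‖z j * ∏ i ∈ s, z i - w j * ∏ i ∈ s, w i‖
        = ‖(z j - w j) * ∏ i ∈ s, z i + w j * (∏ i ∈ s, z i - ∏ i ∈ s, w i)‖ := by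
          congr 1; ring
      _ ≤ ‖z j - w j‖ * ‖∏ i ∈ s, z i‖ + ‖w j‖ * ‖∏ i ∈ s, z i - ∏ i ∈ s, w i‖ := by
          rw [← norm_mul, ← norm_mul]; exact norm_add_le _ _
      _ ≤ ‖z j - w j‖ * 1 + 1 * ∑ i ∈ s, ‖z i - w i‖ := by
          gcongr
          exact hw j
      _ = _ := by ring

/-- The two characteristic functions share their second-order Taylor expansion at `0`, so their
difference is `o(s ^ 2)`. -/
lemma exists_norm_charFun_sub_le {ρ σ : Measure ℝ} [IsProbabilityMeasure ρ]
    [IsProbabilityMeasure σ] (hρ0 : ∫ y, y ∂ρ = 0) (hρ : ∫ y : ℝ, y ^ 2 ∂ρ = 1)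
    (hσ0 : ∫ y, y ∂σ = 0) (hσ : ∫ y : ℝ, y ^ 2 ∂σ = 1) {ε : ℝ} (hε : 0 < ε) :
    ∃ δ > 0, ∀ s : ℝ, |s| ≤ δ → ‖charFun ρ s - charFun σ s‖ ≤ ε * s ^ 2 := by
  have h1 := taylor_charFun_two (P := ρ) (X := id) aemeasurable_id hρ0 (by simpa using hρ)
  have h2 := taylor_charFun_two (P := σ) (X := id) aemeasurable_id hσ0 (by simpa using hσ)
  rw [Measure.map_id] at h1 h2
  have h := (h1.sub h2).def hε
  obtain ⟨δ, hδ, h⟩ := Metric.eventually_nhds_iff.1 h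
  refine ⟨δ / 2, by positivity, fun s hs => ?_⟩
  have := h (y := s) (by rw [Real.dist_eq, sub_zero]; linarith)
  simpa using this

section WeightedSum

variable {μ : Measure ℝ} [IsProbabilityMeasure μ]

/-- The law of the weighted sum `∑ j, x j * a j` of independent variables `a j` of law `μ`. -/
noncomputable def weightedSumLaw (μ : Measure ℝ) {n : ℕ} (x : Fin n → ℝ) : Measure ℝ :=
  (Measure.pi fun _ : Fin n => μ).map fun a => ∑ j, x j * a j

instance {n : ℕ} (x : Fin n → ℝ) : IsProbabilityMeasure (weightedSumLaw μ x) :=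
  Measure.isProbabilityMeasure_map (Measurable.aemeasurable (by fun_prop))

lemma iIndepFun_mul_pi {n : ℕ} (x : Fin n → ℝ) :
    iIndepFun (fun j (a : Fin n → ℝ) => x j * a j) (Measure.pi fun _ : Fin n => μ) :=
  iIndepFun_pi (X := fun j (a : ℝ) => x j * a) fun _ => by fun_prop

lemma charFun_weightedSumLaw {n : ℕ} (x : Fin n → ℝ) (t : ℝ) :
    charFun (weightedSumLaw μ x) t = ∏ j, charFun μ (x j * t) := by
  rw [weightedSumLaw, (iIndepFun_mul_pi x).charFun_map_fun_sum_eq_prod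
    fun _ => Measurable.aemeasurable (by fun_prop),
    Finset.prod_apply]
  refine Finset.prod_congr rfl fun j _ => ?_
  rw [charFun_map_mul_comp (measurable_pi_apply j).aemeasurable]
  congr 1
  exact (measurePreserving_eval (fun _ : Fin n => μ) j).map_eq

lemma integral_sq_weightedSumLaw (h0 : ∫ y, y ∂μ = 0) (h1 : ∫ y : ℝ, y ^ 2 ∂μ = 1) {n : ℕ}
    (x : Fin n → ℝ) : ∫ y, y ^ 2 ∂(weightedSumLaw μ x) = ∑ j, x j ^ 2 := by
  have hi : Integrable (fun y : ℝ => y ^ 2) μ := .of_integral_ne_zero (by simp [h1])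
  have hL : MemLp id 2 μ := (memLp_two_iff_integrable_sq aestronglyMeasurable_id).2 hi
  have hLj : ∀ j, MemLp (fun a : Fin n → ℝ => x j * a j) 2 (Measure.pi fun _ : Fin n => μ) :=
    fun j => (hL.comp_measurePreserving (measurePreserving_eval (fun _ : Fin n => μ) j)).const_mul _
  have hm : ∀ j, ∫ a : Fin n → ℝ, x j * a j ∂(Measure.pi fun _ : Fin n => μ) = 0 := fun j => by
    rw [integral_const_mul, integral_comp_eval (μ := fun _ : Fin n => μ) (f := fun y => y)
      (by fun_prop), h0, mul_zero]
  have hv := IndepFun.variance_sum (s := Finset.univ) (fun j _ => hLj j)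
    (fun i _ j _ hij => (iIndepFun_mul_pi (μ := μ) x).indepFun hij)
  rw [weightedSumLaw, integral_map (Measurable.aemeasurable (by fun_prop)) (by fun_prop)]
  rw [variance_eq_integral (Measurable.aemeasurable (by fun_prop))] at hv
  have hs : ∫ a : Fin n → ℝ, (∑ j, fun a : Fin n → ℝ => x j * a j) a
      ∂(Measure.pi fun _ : Fin n => μ) = 0 := by
    simp only [Finset.sum_apply]
    rw [integral_finsetSum _ fun j _ => (hLj j).integrable (by norm_num)]
    simp [hm]
  rw [hs] at hv
  simp only [Finset.sum_apply, sub_zero] at hv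
  rw [hv]
  refine Finset.sum_congr rfl fun j _ => ?_
  rw [variance_eq_integral (Measurable.aemeasurable (by fun_prop)), hm]
  simp only [sub_zero, mul_pow]
  rw [integral_const_mul, integral_comp_eval (μ := fun _ : Fin n => μ) (f := fun y => y ^ 2)
      (by fun_prop), h1, mul_one]

/-- A central limit theorem for first absolute moments, uniform over the weights. -/
theorem exists_abs_integral_abs_weightedSumLaw_sub_le (h0 : ∫ y, y ∂μ = 0)
    (h1 : ∫ y : ℝ, y ^ 2 ∂μ = 1) {ε : ℝ} (hε : 0 < ε) :
    ∃ η > 0, ∀ (n : ℕ) (x : Fin n → ℝ), ∑ j, x j ^ 2 = 1 → (∀ j, |x j| ≤ η) →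
      |∫ y, |y| ∂(weightedSumLaw μ x) - √(2 / Real.pi)| ≤ ε := by
  obtain ⟨T, hT, δ, hδ, H⟩ := exists_abs_integral_abs_sub_le hε
  have g0 : ∫ y, y ∂(gaussianReal 0 1) = 0 := by simp
  obtain ⟨η, hη, h⟩ := exists_norm_charFun_sub_le h0 h1 g0 integral_sq_gaussianReal hδ
  -- Only `t ≤ T` matters, so this keeps every argument `x j * t` in the range `|·| ≤ η` of the
  -- Taylor comparison.
  refine ⟨η / T, by positivity, fun n x hx hxη => ?_⟩
  rw [← integral_abs_gaussianReal]
  refine H _ _ (by rw [integral_sq_weightedSumLaw h0 h1, hx]) integral_sq_gaussianReal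
    fun t ht => ?_
  -- Since `∑ j, x j ^ 2 = 1`, the Gaussian splits along the same weights and the factors can be
  -- exchanged one by one; the errors `δ * (x j * t) ^ 2` add up to `δ * t ^ 2`.
  have e : charFun (gaussianReal 0 1) t = ∏ j, charFun (gaussianReal 0 1) (x j * t) := by
    simp only [charFun_gaussianReal, ← Complex.exp_sum]
    congr 1
    have : ∑ j, ((x j : ℂ)) ^ 2 = 1 := by exact_mod_cast hx
    simp [mul_pow, ← Finset.sum_div, ← Finset.sum_mul, this]
  rw [charFun_weightedSumLaw, e]
  refine (norm_prod_sub_prod_le _ (fun _ => norm_charFun_le_one _)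
    fun _ => norm_charFun_le_one _).trans ?_
  calc ∑ j, ‖charFun μ (x j * t) - charFun (gaussianReal 0 1) (x j * t)‖
      ≤ ∑ j, δ * (x j * t) ^ 2 := by
        refine Finset.sum_le_sum fun j _ => h _ ?_
        rw [abs_mul, abs_of_pos ht.1]
        calc |x j| * t ≤ η / T * T := mul_le_mul (hxη j) ht.2 ht.1.le (by positivity)
          _ = η := by field_simp
    _ = δ * t ^ 2 := by
        simp_rw [mul_pow]
        rw [← Finset.mul_sum, ← Finset.sum_mul, hx, one_mul]

end WeightedSum

/-! ### Conditioning on an independent variable -/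

section Conditioning

variable {Ω E F : Type*} [MeasurableSpace Ω] [MeasurableSpace E] [MeasurableSpace F]
  {P : Measure Ω} [IsProbabilityMeasure P]

/-- Fubini on the product law of `(X, B)`: a bound for each deterministic `x` may be used at the
random row `X`. Lower integrals spare all integrability conditions. -/
lemma lintegral_le_of_indepFun {X : Ω → E} {B : Ω → F} (hX : Measurable X) (hB : Measurable B)
    (hXB : IndepFun X B P) {f : E → F → ENNReal} (hf : Measurable (Function.uncurry f))
    {g : E → ENNReal} (h : ∀ x, ∫⁻ ω, f x (B ω) ∂P ≤ g x) :
    ∫⁻ ω, f (X ω) (B ω) ∂P ≤ ∫⁻ ω, g (X ω) ∂P := by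
  have hlaw := (indepFun_iff_map_prod_eq_prod_map_map hX.aemeasurable hB.aemeasurable).1 hXB
  have := Measure.isProbabilityMeasure_map (μ := P) hB.aemeasurable
  calc ∫⁻ ω, f (X ω) (B ω) ∂P
      = ∫⁻ z, Function.uncurry f z ∂(P.map fun ω => (X ω, B ω)) := by
        rw [lintegral_map hf (hX.prodMk hB)]; rfl
    _ = ∫⁻ x, ∫⁻ b, f x b ∂(P.map B) ∂(P.map X) := by
        rw [hlaw, lintegral_prod _ hf.aemeasurable]; rfl
    _ = ∫⁻ ω, ∫⁻ b, f (X ω) b ∂(P.map B) ∂P := by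
        exact lintegral_map hf.lintegral_prod_right' hX
    _ ≤ _ := lintegral_mono fun ω => by
        exact (lintegral_map (hf.comp (measurable_prodMk_left (x := X ω))) hB).trans_le (h (X ω))

end Conditioning

/-! ### Moments of weighted sums and of centered iid sums -/

section WeightedMoments

variable {μ : Measure ℝ} [IsProbabilityMeasure μ]

lemma memLp_eval_mul {r : ℝ} (hμ : MemLp id (ENNReal.ofReal r) μ) {n : ℕ} (x : Fin n → ℝ)
    (j : Fin n) : MemLp (fun a : Fin n → ℝ => x j * a j) (ENNReal.ofReal r)
      (Measure.pi fun _ : Fin n => μ) :=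
  (hμ.comp_measurePreserving (measurePreserving_eval (fun _ : Fin n => μ) j)).const_mul _

lemma memLp_id_weightedSumLaw {r : ℝ} (hμ : MemLp id (ENNReal.ofReal r) μ) {n : ℕ}
    (x : Fin n → ℝ) : MemLp id (ENNReal.ofReal r) (weightedSumLaw μ x) := by
  rw [weightedSumLaw, memLp_map_measure_iff aestronglyMeasurable_id
    (Measurable.aemeasurable (by fun_prop))]
  exact memLp_finsetSum Finset.univ fun j _ => memLp_eval_mul hμ x j

lemma integral_abs_rpow_weightedSumLaw_le {r : ℝ} (hr : 2 ≤ r)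
    (hμ : MemLp id (ENNReal.ofReal r) μ) (h0 : ∫ y, y ∂μ = 0) {n : ℕ} (x : Fin n → ℝ) :
    ∫ y, |y| ^ r ∂(weightedSumLaw μ x)
      ≤ momentConst r * (∫ y, |y| ^ r ∂μ) * (∑ j, x j ^ 2) ^ (r / 2) := by
  have hM : 0 ≤ ∫ y, |y| ^ r ∂μ := integral_nonneg fun y => by positivity
  set M := ∫ y, |y| ^ r ∂μ
  have hr0 : r ≠ 0 := by linarith
  have h := integral_abs_sum_rpow_le (P := Measure.pi fun _ : Fin n => μ) Finset.univ
    -- `M ^ r⁻¹` is the `L^r` norm of `μ`, so these are the `L^r` norms of the summands.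
    (Y := fun j a => x j * a j) (x := fun j => |x j| * M ^ r⁻¹) hr (fun j => by positivity)
    (iIndepFun_mul_pi x) (fun j => by fun_prop) (memLp_eval_mul hμ x)
    (fun j => by
      rw [integral_const_mul, integral_comp_eval (μ := fun _ : Fin n => μ) (f := fun y => y)
        (by fun_prop), h0, mul_zero])
    (fun j => by
      simp_rw [abs_mul, Real.mul_rpow (abs_nonneg _) (abs_nonneg _)]
      rw [integral_const_mul, integral_comp_eval (μ := fun _ : Fin n => μ)
        (f := fun y => |y| ^ r) (Measurable.aestronglyMeasurable (by fun_prop)),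
        Real.mul_rpow (abs_nonneg _) (by positivity), ← Real.rpow_mul hM, inv_mul_cancel₀ hr0,
        Real.rpow_one])
  rw [weightedSumLaw, integral_map (Measurable.aemeasurable (by fun_prop))
    (Measurable.aestronglyMeasurable (by fun_prop))]
  refine h.trans_eq ?_
  simp_rw [mul_pow, sq_abs]
  rw [← Finset.sum_mul, Real.mul_rpow (Finset.sum_nonneg fun j _ => sq_nonneg _) (by positivity),
    ← Real.rpow_natCast, ← Real.rpow_mul hM, ← Real.rpow_mul hM,
    show r⁻¹ * ((2 : ℕ) : ℝ) * (r / 2) = 1 by push_cast; field_simp, Real.rpow_one]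
  ring

end WeightedMoments

lemma abs_add_rpow_le_two_rpow {s : ℝ} (hs : 1 ≤ s) (a b : ℝ) :
    |a + b| ^ s ≤ 2 ^ s * (|a| ^ s + |b| ^ s) := by
  rcases le_total |a| |b| with h | h
  · calc |a + b| ^ s ≤ (2 * |b|) ^ s := by
          gcongr; linarith [abs_add_le a b]
      _ = 2 ^ s * |b| ^ s := Real.mul_rpow (by norm_num) (abs_nonneg _)
      _ ≤ _ := by gcongr; linarith [Real.rpow_nonneg (abs_nonneg a) s]
  · calc |a + b| ^ s ≤ (2 * |a|) ^ s := by
          gcongr; linarith [abs_add_le a b]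
      _ = 2 ^ s * |a| ^ s := Real.mul_rpow (by norm_num) (abs_nonneg _)
      _ ≤ _ := by gcongr; linarith [Real.rpow_nonneg (abs_nonneg b) s]

section IIDSum

variable {Ω : Type*} [MeasurableSpace Ω] {P : Measure Ω} [IsProbabilityMeasure P]

/-- Moments of centered sums of functions of independent identically distributed variables. -/
lemma lintegral_abs_sum_sub_rpow_le {ρ : Measure ℝ} [IsProbabilityMeasure ρ] {n : ℕ}
    {Y : Fin n → Ω → ℝ} (hind : iIndepFun Y P) (hmeas : ∀ k, Measurable (Y k))
    (hlaw : ∀ k, P.map (Y k) = ρ) {f : ℝ → ℝ} (hf : Measurable f) {s : ℝ} (hs : 2 ≤ s)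
    (hfs : MemLp f (ENNReal.ofReal s) ρ) :
    ∫⁻ ω, ENNReal.ofReal (|∑ k, (f (Y k ω) - ∫ y, f y ∂ρ)| ^ s) ∂P
      ≤ ENNReal.ofReal (momentConst s * (2 * 2 ^ s * ∫ y, |f y| ^ s ∂ρ) * (n : ℝ) ^ (s / 2)) := by
  have hM : 0 ≤ ∫ y, |f y| ^ s ∂ρ := integral_nonneg fun y => by positivity
  set M := ∫ y, |f y| ^ s ∂ρ
  set c := ∫ y, f y ∂ρ
  have hs0 : s ≠ 0 := by linarith
  have hfi : Integrable f ρ := hfs.integrable (by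
    rw [← ENNReal.ofReal_one]; exact ENNReal.ofReal_le_ofReal (by linarith))
  have hfc : MemLp (fun y => f y - c) (ENNReal.ofReal s) ρ := hfs.sub (memLp_const c)
  have hmp : ∀ k, MeasurePreserving (Y k) P ρ := fun k => ⟨hmeas k, hlaw k⟩
  have hZ : ∀ k, MemLp (fun ω => f (Y k ω) - c) (ENNReal.ofReal s) P := fun k =>
    hfc.comp_measurePreserving (hmp k)
  have hint : ∀ (k : Fin n) (g : ℝ → ℝ), Measurable g → ∫ ω, g (Y k ω) ∂P = ∫ y, g y ∂ρ :=
    fun k g hg => by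
      rw [← hlaw k, integral_map (hmeas k).aemeasurable hg.aestronglyMeasurable]
  have hcs : |c| ^ s ≤ M := by
    have h1 : |c| ≤ ∫ y, |f y| ∂ρ := abs_integral_le_integral_abs
    have h2 := integral_abs_rpow_le hfs zero_le_one (by linarith : (1 : ℝ) ≤ s)
    simp only [Real.rpow_one] at h2
    calc |c| ^ s ≤ (M ^ (1 / s)) ^ s := by gcongr; exact h1.trans h2
      _ = M := by rw [← Real.rpow_mul hM, one_div_mul_cancel hs0, Real.rpow_one]
  have h := integral_abs_sum_rpow_le (P := P) Finset.univ (Y := fun k ω => f (Y k ω) - c)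
    -- `2 * 2 ^ s * M` bounds the `s`-th moment of `f - c`: the centering `c` costs at most another
    -- `M`, by `hcs`.
    (x := fun _ => (2 * 2 ^ s * M) ^ s⁻¹) hs (fun k => by positivity)
    (hind.comp (fun _ y => f y - c) fun _ => by fun_prop) (fun k => by fun_prop) hZ
    (fun k => by
      rw [hint k (fun y => f y - c) (by fun_prop), integral_sub hfi (integrable_const c)]
      simp [c])
    (fun k => by
      rw [hint k (fun y => |f y - c| ^ s) (by fun_prop), ← Real.rpow_mul (by positivity),
        inv_mul_cancel₀ hs0, Real.rpow_one]
      have hi := hfs.integrable_abs_rpow (by linarith : 0 ≤ s) le_rfl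
      calc ∫ y, |f y - c| ^ s ∂ρ ≤ ∫ y, 2 ^ s * (|f y| ^ s + |c| ^ s) ∂ρ := by
            refine integral_mono (hfc.integrable_abs_rpow (by linarith : 0 ≤ s) le_rfl)
              ((hi.add (integrable_const _)).const_mul _) fun y => ?_
            simpa [sub_eq_add_neg] using abs_add_rpow_le_two_rpow (by linarith : 1 ≤ s) (f y) (-c)
        _ = 2 ^ s * (M + |c| ^ s) := by
            rw [integral_const_mul, integral_add hi (integrable_const _)]; simp [M]
        _ ≤ 2 ^ s * (M + M) := by gcongr
        _ = _ := by ring)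
  rw [← ofReal_integral_eq_lintegral_ofReal]
  · refine ENNReal.ofReal_le_ofReal (h.trans_eq ?_)
    rw [Finset.sum_const, Finset.card_univ, Fintype.card_fin, nsmul_eq_mul,
      Real.mul_rpow (by positivity) (by positivity), ← Real.rpow_natCast (_ ^ s⁻¹),
      ← Real.rpow_mul (by positivity), ← Real.rpow_mul (by positivity),
      show s⁻¹ * (((2 : ℕ) : ℝ) * (s / 2)) = 1 by push_cast; field_simp, Real.rpow_one]
    ring
  · exact (memLp_finsetSum Finset.univ fun k _ => hZ k).integrable_abs_rpow (by linarith) le_rfl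
  · exact Filter.Eventually.of_forall fun ω => by positivity

end IIDSum

/-! ### Deterministic weights against a matrix with iid entries -/

section Columns

variable {Ω : Type*} [MeasurableSpace Ω]

/-- The entries of the random matrix `B` are independent of law `μ`, expressed through the
columns. -/
structure HasIIDColumns {m n : ℕ} (B : Ω → Fin m → Fin n → ℝ) (μ : Measure ℝ) (P : Measure Ω) :
    Prop where
  measurable : Measurable B
  indep : iIndepFun (fun k ω j => B ω j k) P
  map_eq : ∀ k, P.map (fun ω j => B ω j k) = Measure.pi fun _ => μ

variable {P : Measure Ω} {m n : ℕ} {B : Ω → Fin m → Fin n → ℝ} {μ : Measure ℝ}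

lemma HasIIDColumns.measurable_entry (hB : HasIIDColumns B μ P) (j : Fin m) (k : Fin n) :
    Measurable fun ω => B ω j k := by
  have := hB.measurable
  fun_prop

lemma HasIIDColumns.measurable_sum (hB : HasIIDColumns B μ P) (x : Fin m → ℝ) (k : Fin n) :
    Measurable fun ω => ∑ j, x j * B ω j k :=
  Finset.measurable_sum _ fun j _ => (hB.measurable_entry j k).const_mul _

lemma HasIIDColumns.iIndepFun_sum (hB : HasIIDColumns B μ P) (x : Fin m → ℝ) :
    iIndepFun (fun k ω => ∑ j, x j * B ω j k) P :=
  hB.indep.comp (fun _ b => ∑ j, x j * b j) fun _ => by fun_prop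

lemma HasIIDColumns.map_sum (hB : HasIIDColumns B μ P) (x : Fin m → ℝ) (k : Fin n) :
    P.map (fun ω => ∑ j, x j * B ω j k) = weightedSumLaw μ x := by
  rw [weightedSumLaw, ← hB.map_eq k, Measure.map_map (by fun_prop)
    (measurable_pi_lambda _ fun j => hB.measurable_entry j k)]
  rfl

lemma HasIIDColumns.lintegral_comp_sum (hB : HasIIDColumns B μ P) (x : Fin m → ℝ) (k : Fin n)
    {f : ℝ → ENNReal} (hf : Measurable f) :
    ∫⁻ ω, f (∑ j, x j * B ω j k) ∂P = ∫⁻ y, f y ∂(weightedSumLaw μ x) := by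
  rw [← hB.map_sum x k, lintegral_map hf (hB.measurable_sum x k)]

variable [IsProbabilityMeasure μ]

lemma HasIIDColumns.lintegral_abs_rpow_le (hB : HasIIDColumns B μ P) {r : ℝ} (hr : 2 ≤ r)
    (hμ : MemLp id (ENNReal.ofReal r) μ) (h0 : ∫ y, y ∂μ = 0) (x : Fin m → ℝ) (k : Fin n) :
    ∫⁻ ω, ENNReal.ofReal (|∑ j, x j * B ω j k| ^ r) ∂P
      ≤ ENNReal.ofReal (momentConst r * (∫ y, |y| ^ r ∂μ) * (∑ j, x j ^ 2) ^ (r / 2)) := by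
  rw [hB.lintegral_comp_sum x k (f := fun y => ENNReal.ofReal (|y| ^ r)) (by fun_prop),
    ← ofReal_integral_eq_lintegral_ofReal (f := fun y => |y| ^ r)
      ((memLp_id_weightedSumLaw hμ x).integrable_abs_rpow (by linarith) le_rfl)
      (Filter.Eventually.of_forall fun y => by positivity)]
  exact ENNReal.ofReal_le_ofReal (integral_abs_rpow_weightedSumLaw_le hr hμ h0 x)

/-- The column sums are iid and their squares have mean `∑ j, x j ^ 2`. An `s`-th moment of the
squares requires a moment of order `2 * s` of the entries. -/
lemma HasIIDColumns.lintegral_sum_sq_sub_le [IsProbabilityMeasure P] (hB : HasIIDColumns B μ P)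
    {s : ℝ} (hs : 2 ≤ s) (hμ : MemLp id (ENNReal.ofReal (2 * s)) μ) (h0 : ∫ y, y ∂μ = 0)
    (h1 : ∫ y : ℝ, y ^ 2 ∂μ = 1) (x : Fin m → ℝ) :
    ∫⁻ ω, ENNReal.ofReal (|∑ k, (∑ j, x j * B ω j k) ^ 2 - n * ∑ j, x j ^ 2| ^ s) ∂P
      ≤ ENNReal.ofReal (momentConst s * (2 * 2 ^ s *
          (momentConst (2 * s) * (∫ y, |y| ^ (2 * s) ∂μ) * (∑ j, x j ^ 2) ^ s))
          * (n : ℝ) ^ (s / 2)) := by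
  have hK := one_le_momentConst (by linarith : 1 ≤ s)
  have e : ∀ y : ℝ, |y ^ 2| ^ s = |y| ^ (2 * s) := fun y => by
    rw [abs_pow, ← Real.rpow_natCast, ← Real.rpow_mul (abs_nonneg _)]; norm_num
  have hL : MemLp (fun y : ℝ => y ^ 2) (ENNReal.ofReal s) (weightedSumLaw μ x) := by
    rw [← integrable_norm_rpow_iff (by fun_prop) (by simp; linarith) ENNReal.ofReal_ne_top,
      ENNReal.toReal_ofReal (by linarith)]
    simp_rw [Real.norm_eq_abs, e]
    exact (memLp_id_weightedSumLaw hμ x).integrable_abs_rpow (by linarith) le_rfl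
  have h := lintegral_abs_sum_sub_rpow_le (hB.iIndepFun_sum x) (hB.measurable_sum x) (hB.map_sum x)
    (f := fun y => y ^ 2) (by fun_prop) hs hL
  simp_rw [integral_sq_weightedSumLaw h0 h1, e, Finset.sum_sub_distrib] at h
  simp only [Finset.sum_const, Finset.card_univ, Fintype.card_fin, nsmul_eq_mul] at h
  refine h.trans (ENNReal.ofReal_le_ofReal ?_)
  have := integral_abs_rpow_weightedSumLaw_le (by linarith : 2 ≤ 2 * s) hμ h0 x
  rw [mul_div_cancel_left₀ s two_ne_zero] at this
  gcongr

/-- With absolute values in place of squares, order `s` suffices; this is why the last factor needs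
only half as many moments. -/
lemma HasIIDColumns.lintegral_sum_abs_sub_le [IsProbabilityMeasure P] (hB : HasIIDColumns B μ P)
    {s : ℝ} (hs : 2 ≤ s) (hμ : MemLp id (ENNReal.ofReal s) μ) (h0 : ∫ y, y ∂μ = 0)
    (x : Fin m → ℝ) :
    ∫⁻ ω, ENNReal.ofReal (|∑ k, |∑ j, x j * B ω j k| - n * ∫ y, |y| ∂(weightedSumLaw μ x)| ^ s) ∂P
      ≤ ENNReal.ofReal (momentConst s * (2 * 2 ^ s *
          (momentConst s * (∫ y, |y| ^ s ∂μ) * (∑ j, x j ^ 2) ^ (s / 2)))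
          * (n : ℝ) ^ (s / 2)) := by
  have hK := one_le_momentConst (by linarith : 1 ≤ s)
  have h := lintegral_abs_sum_sub_rpow_le (hB.iIndepFun_sum x) (hB.measurable_sum x) (hB.map_sum x)
    (f := fun y => |y|) (by fun_prop) hs (memLp_id_weightedSumLaw hμ x).abs
  simp_rw [abs_abs, Finset.sum_sub_distrib] at h
  simp only [Finset.sum_const, Finset.card_univ, Fintype.card_fin, nsmul_eq_mul] at h
  refine h.trans (ENNReal.ofReal_le_ofReal ?_)
  have := integral_abs_rpow_weightedSumLaw_le hs hμ h0 x
  gcongr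

end Columns

lemma lintegral_ofReal_const_mul {Ω : Type*} [MeasurableSpace Ω] {P : Measure Ω} {c : ℝ}
    (hc : 0 ≤ c) (f : Ω → ℝ) :
    ∫⁻ ω, ENNReal.ofReal (c * f ω) ∂P = ENNReal.ofReal c * ∫⁻ ω, ENNReal.ofReal (f ω) ∂P := by
  simp_rw [ENNReal.ofReal_mul hc]
  rw [lintegral_const_mul' _ _ ENNReal.ofReal_ne_top]

/-- The factor by which `2 * s`-th moments grow under multiplication by an iid matrix whose entries
have a `2 * s`-th moment at most `M`. -/
noncomputable def rowMomentConst (s M : ℝ) : ℝ := momentConst (2 * s) * M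

lemma rowMomentConst_nonneg {s M : ℝ} (hs : 1 ≤ s) (hM : 0 ≤ M) : 0 ≤ rowMomentConst s M := by
  have := one_le_momentConst (by linarith : 1 ≤ 2 * s)
  unfold rowMomentConst; positivity

/-- The constant of `HasIIDColumns.lintegral_mean_sq_sub_rpow_le`. -/
noncomputable def rowDeviationConst (s M : ℝ) : ℝ :=
  momentConst s * (2 * 2 ^ s * rowMomentConst s M)

lemma rowDeviationConst_nonneg {s M : ℝ} (hs : 1 ≤ s) (hM : 0 ≤ M) :
    0 ≤ rowDeviationConst s M := by
  have := one_le_momentConst hs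
  have := rowMomentConst_nonneg hs hM
  unfold rowDeviationConst; positivity

/-! ### A random row multiplied by an independent iid matrix -/

section RandomRow

variable {Ω : Type*} [MeasurableSpace Ω] {P : Measure Ω} [IsProbabilityMeasure P] {m n : ℕ}
  {B : Ω → Fin m → Fin n → ℝ} {X : Ω → Fin m → ℝ} {μ : Measure ℝ} [IsProbabilityMeasure μ]
  {s M : ℝ}

lemma HasIIDColumns.lintegral_entry_rpow_le (hB : HasIIDColumns B μ P) (hX : Measurable X)
    (hXB : IndepFun X B P) (hs : 1 ≤ s) (hμ : MemLp id (ENNReal.ofReal (2 * s)) μ)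
    (hM : ∫ y, |y| ^ (2 * s) ∂μ ≤ M) (h0 : ∫ y, y ∂μ = 0) (k : Fin n) :
    ∫⁻ ω, ENNReal.ofReal (|∑ j, X ω j * B ω j k| ^ (2 * s)) ∂P
      ≤ ENNReal.ofReal (rowMomentConst s M) *
        ∫⁻ ω, ENNReal.ofReal ((∑ j, X ω j ^ 2) ^ s) ∂P := by
  have hK := one_le_momentConst (by linarith : 1 ≤ 2 * s)
  have hM0 : 0 ≤ M := (integral_nonneg fun y => by positivity).trans hM
  rw [← lintegral_ofReal_const_mul (rowMomentConst_nonneg hs hM0)]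
  refine lintegral_le_of_indepFun hX hB.measurable hXB
    (f := fun x b => ENNReal.ofReal (|∑ j, x j * b j k| ^ (2 * s)))
    (g := fun x => ENNReal.ofReal (rowMomentConst s M * (∑ j, x j ^ 2) ^ s))
    (by unfold Function.uncurry; fun_prop) fun x => ?_
  refine (hB.lintegral_abs_rpow_le (by linarith) hμ h0 x k).trans (ENNReal.ofReal_le_ofReal ?_)
  rw [mul_div_cancel_left₀ s two_ne_zero, rowMomentConst]
  gcongr

/-- One normalized multiplication preserves the squared Euclidean norm in conditional mean;
averaging over `n` columns leaves a relative `L^s` error of order `n ^ (-1/2)`. -/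
lemma HasIIDColumns.lintegral_mean_sq_sub_rpow_le (hB : HasIIDColumns B μ P) (hX : Measurable X)
    (hXB : IndepFun X B P) (hn : 0 < n) (hs : 2 ≤ s) (hμ : MemLp id (ENNReal.ofReal (2 * s)) μ)
    (hM : ∫ y, |y| ^ (2 * s) ∂μ ≤ M) (h0 : ∫ y, y ∂μ = 0) (h1 : ∫ y : ℝ, y ^ 2 ∂μ = 1) :
    ∫⁻ ω, ENNReal.ofReal
        (|(n : ℝ)⁻¹ * ∑ k, (∑ j, X ω j * B ω j k) ^ 2 - ∑ j, X ω j ^ 2| ^ s) ∂P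
      ≤ ENNReal.ofReal (rowDeviationConst s M * (n : ℝ) ^ (-(s / 2))) *
        ∫⁻ ω, ENNReal.ofReal ((∑ j, X ω j ^ 2) ^ s) ∂P := by
  have hn' : (0 : ℝ) < n := by exact_mod_cast hn
  have hK := one_le_momentConst (by linarith : 1 ≤ 2 * s)
  have hK' := one_le_momentConst (by linarith : 1 ≤ s)
  have hM0 : 0 ≤ M := (integral_nonneg fun y => by positivity).trans hM
  have hD := rowDeviationConst_nonneg (by linarith : 1 ≤ s) hM0
  rw [← lintegral_ofReal_const_mul (by positivity)]
  refine lintegral_le_of_indepFun hX hB.measurable hXB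
    (f := fun x b => ENNReal.ofReal
      (|(n : ℝ)⁻¹ * ∑ k, (∑ j, x j * b j k) ^ 2 - ∑ j, x j ^ 2| ^ s))
    (g := fun x => ENNReal.ofReal (rowDeviationConst s M * (n : ℝ) ^ (-(s / 2)) *
      (∑ j, x j ^ 2) ^ s)) (by unfold Function.uncurry; fun_prop) fun x => ?_
  have e : ∀ z w : ℝ, |(n : ℝ)⁻¹ * z - w| ^ s = (n : ℝ) ^ (-s) * |z - n * w| ^ s := fun z w => by
    rw [show (n : ℝ)⁻¹ * z - w = (n : ℝ)⁻¹ * (z - n * w) by field_simp, abs_mul,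
      Real.mul_rpow (abs_nonneg _) (abs_nonneg _), abs_of_pos (by positivity),
      Real.inv_rpow hn'.le, Real.rpow_neg hn'.le]
  simp_rw [e]
  rw [lintegral_ofReal_const_mul (by positivity)]
  refine (mul_le_mul_right (hB.lintegral_sum_sq_sub_le hs hμ h0 h1 x) _).trans ?_
  rw [← ENNReal.ofReal_mul (by positivity)]
  refine ENNReal.ofReal_le_ofReal ?_
  have hS : 0 ≤ (∑ j, x j ^ 2) ^ s :=
    Real.rpow_nonneg (Finset.sum_nonneg fun j _ => sq_nonneg _) _
  have e2 : (n : ℝ) ^ (-(s / 2)) = (n : ℝ) ^ (-s) * (n : ℝ) ^ (s / 2) := by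
    rw [← Real.rpow_add hn']; congr 1; ring
  calc _ ≤ (n : ℝ) ^ (-s) * (momentConst s * (2 * 2 ^ s * (momentConst (2 * s) * M *
          (∑ j, x j ^ 2) ^ s)) * (n : ℝ) ^ (s / 2)) := by gcongr
    _ = _ := by rw [e2, rowDeviationConst, rowMomentConst]; ring

lemma HasIIDColumns.lintegral_mean_sq_rpow_le (hB : HasIIDColumns B μ P) (hX : Measurable X)
    (hXB : IndepFun X B P) (hn : 0 < n) (hs : 1 ≤ s) (hμ : MemLp id (ENNReal.ofReal (2 * s)) μ)
    (hM : ∫ y, |y| ^ (2 * s) ∂μ ≤ M) (h0 : ∫ y, y ∂μ = 0) :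
    ∫⁻ ω, ENNReal.ofReal (((n : ℝ)⁻¹ * ∑ k, (∑ j, X ω j * B ω j k) ^ 2) ^ s) ∂P
      ≤ ENNReal.ofReal (rowMomentConst s M) *
        ∫⁻ ω, ENNReal.ofReal ((∑ j, X ω j ^ 2) ^ s) ∂P := by
  have hn' : (0 : ℝ) < n := by exact_mod_cast hn
  have hB' := hB.measurable
  have hle : ∀ y : Fin n → ℝ, ((n : ℝ)⁻¹ * ∑ k, y k ^ 2) ^ s
      ≤ (n : ℝ)⁻¹ * ∑ k, |y k| ^ (2 * s) := fun y => by
    -- Convexity reduces the moment of the average to single entries, without independence between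
    -- columns.
    have h := Real.rpow_arith_mean_le_arith_mean_rpow Finset.univ (fun _ : Fin n => (n : ℝ)⁻¹)
      (fun k => y k ^ 2) (fun _ _ => by positivity) (by simp [hn'.ne'])
      (fun k _ => sq_nonneg _) hs
    simp only [← Finset.mul_sum] at h
    refine h.trans_eq ?_
    congr 1
    refine Finset.sum_congr rfl fun k _ => ?_
    rw [← sq_abs, ← Real.rpow_natCast, ← Real.rpow_mul (abs_nonneg _)]; norm_num
  calc _ ≤ ∫⁻ ω, ENNReal.ofReal ((n : ℝ)⁻¹ * ∑ k, |∑ j, X ω j * B ω j k| ^ (2 * s)) ∂P :=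
        lintegral_mono fun ω => ENNReal.ofReal_le_ofReal (hle _)
    _ = ENNReal.ofReal (n : ℝ)⁻¹ *
          ∑ k, ∫⁻ ω, ENNReal.ofReal (|∑ j, X ω j * B ω j k| ^ (2 * s)) ∂P := by
        rw [lintegral_ofReal_const_mul (by positivity), ← lintegral_finsetSum _ fun k _ => by
          fun_prop]
        simp_rw [ENNReal.ofReal_sum_of_nonneg fun k _ => Real.rpow_nonneg (abs_nonneg _) _]
    _ ≤ ENNReal.ofReal (n : ℝ)⁻¹ * ∑ _k : Fin n, ENNReal.ofReal (rowMomentConst s M) *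
        ∫⁻ ω, ENNReal.ofReal ((∑ j, X ω j ^ 2) ^ s) ∂P := by
        gcongr with k
        exact hB.lintegral_entry_rpow_le hX hXB hs hμ hM h0 k
    _ = _ := by
        rw [Finset.sum_const, Finset.card_univ, Fintype.card_fin, nsmul_eq_mul, ← mul_assoc,
          ← ENNReal.ofReal_natCast, ← ENNReal.ofReal_mul (by positivity),
          inv_mul_cancel₀ hn'.ne', ENNReal.ofReal_one, one_mul]

end RandomRow

/-! ### Grouping independent families -/

section Independence

variable {Ω : Type*} [MeasurableSpace Ω] {P : Measure Ω}

lemma ProbabilityTheory.iIndepFun.indepFun_castSucc_last {p : ℕ} {β : Fin (p + 1) → Type*}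
    [∀ q, MeasurableSpace (β q)] {B : (q : Fin (p + 1)) → Ω → β q} (h : iIndepFun B P)
    (hB : ∀ q, Measurable (B q)) :
    IndepFun (fun ω (q : Fin p) => B q.castSucc ω) (B (Fin.last p)) P := by
  have h1 := h.indepFun_finset (Finset.univ.image Fin.castSucc) {Fin.last p}
    (by simp) hB
  have h2 := h1.comp
    (φ := fun g (q : Fin p) => g ⟨q.castSucc, Finset.mem_image_of_mem _ (Finset.mem_univ q)⟩)
    (ψ := fun g => g ⟨Fin.last p, Finset.mem_singleton_self _⟩)
    (measurable_pi_lambda _ fun q => measurable_pi_apply _)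
    (measurable_pi_apply (X := fun q : ({Fin.last p} : Finset (Fin (p + 1))) => β q)
      ⟨Fin.last p, Finset.mem_singleton_self _⟩)
  exact h2

/-- Grouping independent variables indexed by a sigma type. -/
lemma ProbabilityTheory.iIndepFun.sigma_curry {ι : Type*} {κ : ι → Type*} {X : (Σ i, κ i) → Ω → ℝ}
    (h : iIndepFun X P) (hX : ∀ e, Measurable (X e)) :
    iIndepFun (fun i ω (j : κ i) => X ⟨i, j⟩ ω) P := by
  have := h.isProbabilityMeasure
  have hp : ∀ e, IsProbabilityMeasure (P.map (X e)) := fun e =>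
    Measure.isProbabilityMeasure_map (hX e).aemeasurable
  have hp' : ∀ i, IsProbabilityMeasure (P.map fun ω (j : κ i) => X ⟨i, j⟩ ω) := fun i =>
    Measure.isProbabilityMeasure_map (measurable_pi_lambda _ fun j => hX _).aemeasurable
  -- Independence is rephrased as a product law; a product over the sigma type curries to a product
  -- of products.
  rw [iIndepFun_iff_map_fun_eq_infinitePi_map fun i => measurable_pi_lambda _ fun j => hX _]
  have hi : ∀ i, P.map (fun ω (j : κ i) => X ⟨i, j⟩ ω)
      = Measure.infinitePi fun j => P.map (X ⟨i, j⟩) := fun i =>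
    (h.precomp (g := fun j : κ i => (⟨i, j⟩ : Σ i, κ i))
      sigma_mk_injective).map_fun_eq_infinitePi_map fun j => hX _
  simp_rw [hi]
  rw [← Measure.infinitePi_map_piCurry (X := fun i (_ : κ i) => ℝ)
    (fun i (j : κ i) => P.map (X ⟨i, j⟩))]
  have h1 := h.map_fun_eq_infinitePi_map hX
  rw [show (fun p : (i : ι) × κ i => P.map (X ⟨p.1, p.2⟩)) = fun e => P.map (X e) from rfl, ← h1,
    Measure.map_map (MeasurableEquiv.measurable _) (measurable_pi_lambda _ hX)]
  rfl

end Independence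

/-! ### Concentration of the Euclidean norm of a row -/

section NormRow

/-- The row number `i` of a product of matrices, divided by the typical size of its Euclidean
norm. -/
noncomputable def normRow (p : ℕ) (n : Fin (p + 1) → ℕ)
    (A : (q : Fin p) → Fin (n q.castSucc) → Fin (n q.succ) → ℝ) (i : Fin (n 0)) :
    Fin (n (Fin.last p)) → ℝ :=
  fun k => (√(∏ q : Fin p, (n q.succ : ℝ)))⁻¹ * chainProd p n A i k

lemma normRow_succ (p : ℕ) (n : Fin (p + 2) → ℕ)
    (A : (q : Fin (p + 1)) → Fin (n q.castSucc) → Fin (n q.succ) → ℝ) (i : Fin (n 0))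
    (k : Fin (n (Fin.last (p + 1)))) :
    normRow (p + 1) n A i k = (√(n (Fin.last (p + 1)) : ℝ))⁻¹ *
      ∑ j, normRow p (fun q => n q.castSucc) (fun q => A q.castSucc) i j * A (Fin.last p) j k := by
  have e : chainProd (p + 1) n A i k
      = ∑ j, chainProd p (fun q => n q.castSucc) (fun q => A q.castSucc) i j * A (Fin.last p) j k :=
    rfl
  simp only [normRow]
  rw [e, Fin.prod_univ_castSucc, Real.sqrt_mul (Finset.prod_nonneg fun q _ => by positivity),
    Fin.succ_last, mul_inv, Finset.mul_sum, Finset.mul_sum]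
  refine Finset.sum_congr rfl fun j _ => ?_
  simp only [Fin.succ_castSucc]
  ring

lemma measurable_chainProd (p : ℕ) (n : Fin (p + 1) → ℕ) (i : Fin (n 0))
    (k : Fin (n (Fin.last p))) :
    Measurable fun A : (q : Fin p) → Fin (n q.castSucc) → Fin (n q.succ) → ℝ =>
      chainProd p n A i k := by
  induction p with
  | zero => exact measurable_const
  | succ p ih =>
    have h : ∀ j, Measurable fun A : (q : Fin (p + 1)) → Fin (n q.castSucc) → Fin (n q.succ) → ℝ =>
        chainProd p (fun q => n q.castSucc) (fun q => A q.castSucc) i j := fun j =>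
      (ih (fun q => n q.castSucc) i j).comp
        (measurable_pi_lambda _ fun q => measurable_pi_apply q.castSucc)
    change Measurable fun A : (q : Fin (p + 1)) → Fin (n q.castSucc) → Fin (n q.succ) → ℝ =>
      ∑ j, chainProd p (fun q => n q.castSucc) (fun q => A q.castSucc) i j * A (Fin.last p) j k
    refine Finset.measurable_sum _ fun j _ => (h j).mul ?_
    fun_prop

lemma measurable_normRow (p : ℕ) (n : Fin (p + 1) → ℕ) (i : Fin (n 0)) :
    Measurable fun A : (q : Fin p) → Fin (n q.castSucc) → Fin (n q.succ) → ℝ =>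
      normRow p n A i :=
  measurable_pi_lambda _ fun k => (measurable_chainProd p n i k).const_mul _

/-- The constant of `lintegral_normRow_deviation_le`. -/
noncomputable def normRowConst (s M : ℝ) : ℕ → ℝ
  | 0 => 0
  | p + 1 => 2 ^ s * (rowDeviationConst s M * rowMomentConst s M ^ p + normRowConst s M p)

lemma normRowConst_nonneg {s M : ℝ} (hs : 1 ≤ s) (hM : 0 ≤ M) (p : ℕ) :
    0 ≤ normRowConst s M p := by
  have := rowDeviationConst_nonneg hs hM
  have := rowMomentConst_nonneg hs hM
  induction p with
  | zero => exact le_rfl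
  | succ p ih => unfold normRowConst; positivity

variable {Ω : Type*} [MeasurableSpace Ω] {P : Measure Ω} [IsProbabilityMeasure P] {s M : ℝ}

lemma sum_normRow_succ_sq (p : ℕ) (n : Fin (p + 2) → ℕ)
    (A : (q : Fin (p + 1)) → Fin (n q.castSucc) → Fin (n q.succ) → ℝ) (i : Fin (n 0)) :
    ∑ k, normRow (p + 1) n A i k ^ 2 = (n (Fin.last (p + 1)) : ℝ)⁻¹ * ∑ k, (∑ j,
      normRow p (fun q => n q.castSucc) (fun q => A q.castSucc) i j * A (Fin.last p) j k) ^ 2 := by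
  simp_rw [normRow_succ, mul_pow, inv_pow]
  rw [Real.sq_sqrt (by positivity), Finset.mul_sum]
  rfl

lemma sum_normRow_zero_sq (n : Fin (0 + 1) → ℕ)
    (A : (q : Fin 0) → Fin (n q.castSucc) → Fin (n q.succ) → ℝ) (i : Fin (n 0)) :
    ∑ k, normRow 0 n A i k ^ 2 = 1 := by
  change ∑ k : Fin (n 0), ((√(∏ q : Fin 0, (n q.succ : ℝ)))⁻¹ *
    (1 : Matrix (Fin (n 0)) (Fin (n 0)) ℝ) i k) ^ 2 = 1
  rw [Finset.sum_eq_single_of_mem i (Finset.mem_univ i) (by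
    intro k _ hk; simp [hk.symm])]
  simp

/-- Moments of the squared Euclidean norm of a normalized row. -/
theorem lintegral_normRow_rpow_le (hs : 1 ≤ s) (hM : 0 ≤ M) (p : ℕ) (n : Fin (p + 1) → ℕ)
    (hn : ∀ q, 0 < n q) (μ : Fin p → Measure ℝ) [∀ q, IsProbabilityMeasure (μ q)]
    (h0 : ∀ q, ∫ y, y ∂(μ q) = 0) (hμ : ∀ q, MemLp id (ENNReal.ofReal (2 * s)) (μ q))
    (hμM : ∀ q, ∫ y, |y| ^ (2 * s) ∂(μ q) ≤ M)
    (B : (q : Fin p) → Ω → Fin (n q.castSucc) → Fin (n q.succ) → ℝ)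
    (hB : ∀ q, HasIIDColumns (B q) (μ q) P) (hind : iIndepFun B P) (i : Fin (n 0)) :
    ∫⁻ ω, ENNReal.ofReal ((∑ k, normRow p n (fun q => B q ω) i k ^ 2) ^ s) ∂P
      ≤ ENNReal.ofReal (rowMomentConst s M ^ p) := by
  induction p with
  | zero =>
    have h : ∀ ω, ∑ k, normRow 0 n (fun q => B q ω) i k ^ 2 = 1 := fun ω =>
      sum_normRow_zero_sq n (fun q => B q ω) i
    exact (lintegral_congr fun ω => by rw [h]).trans_le (by simp)
  | succ p ih =>
    have hC := rowMomentConst_nonneg hs hM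
    have ih' := ih (fun q => n q.castSucc) (fun q => hn _) (fun q => μ q.castSucc) (fun q => h0 _)
      (fun q => hμ _) (fun q => hμM _) (fun q => B q.castSucc) (fun q => hB _)
      (hind.precomp (Fin.castSucc_injective p)) i
    have hXB := (hind.indepFun_castSucc_last fun q => (hB q).measurable).comp
      (measurable_normRow p (fun q => n q.castSucc) i) measurable_id
    have hX := (measurable_normRow p (fun q => n q.castSucc) i).comp
      (measurable_pi_lambda (fun ω (q : Fin p) => B q.castSucc ω) fun q => (hB _).measurable)
    simp_rw [sum_normRow_succ_sq]
    refine ((hB (Fin.last p)).lintegral_mean_sq_rpow_le hX hXB (hn _) hs (hμ _) (hμM _)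
      (h0 _)).trans ?_
    rw [pow_succ', ENNReal.ofReal_mul hC]
    exact mul_le_mul_right ih' _

/-- The squared Euclidean norm of a normalized row is concentrated around `1`. -/
theorem lintegral_normRow_deviation_le (hs : 2 ≤ s) (hM : 0 ≤ M) (p : ℕ) (n : Fin (p + 1) → ℕ)
    (hn : ∀ q, 0 < n q) (μ : Fin p → Measure ℝ) [∀ q, IsProbabilityMeasure (μ q)]
    (h0 : ∀ q, ∫ y, y ∂(μ q) = 0) (h1 : ∀ q, ∫ y : ℝ, y ^ 2 ∂(μ q) = 1)
    (hμ : ∀ q, MemLp id (ENNReal.ofReal (2 * s)) (μ q))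
    (hμM : ∀ q, ∫ y, |y| ^ (2 * s) ∂(μ q) ≤ M)
    (B : (q : Fin p) → Ω → Fin (n q.castSucc) → Fin (n q.succ) → ℝ)
    (hB : ∀ q, HasIIDColumns (B q) (μ q) P) (hind : iIndepFun B P) (i : Fin (n 0))
    {t : ℝ} (ht : 0 < t) (htn : ∀ q, t ≤ n q) :
    ∫⁻ ω, ENNReal.ofReal (|∑ k, normRow p n (fun q => B q ω) i k ^ 2 - 1| ^ s) ∂P
      ≤ ENNReal.ofReal (normRowConst s M p * t ^ (-(s / 2))) := by
  induction p with
  | zero =>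
    have h : ∀ ω, ∑ k, normRow 0 n (fun q => B q ω) i k ^ 2 = 1 := fun ω =>
      sum_normRow_zero_sq n (fun q => B q ω) i
    exact (lintegral_congr (g := 0) fun ω => by
      rw [h, sub_self, abs_zero, Real.zero_rpow (by linarith : s ≠ 0), ENNReal.ofReal_zero]
      rfl).trans_le (by simp)
  | succ p ih =>
    have hs1 : 1 ≤ s := by linarith
    have hC := rowMomentConst_nonneg hs1 hM
    have hD := rowDeviationConst_nonneg hs1 hM
    have hind' := hind.precomp (Fin.castSucc_injective p)
    have ih' := ih (fun q => n q.castSucc) (fun q => hn _) (fun q => μ q.castSucc) (fun q => h0 _)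
      (fun q => h1 _) (fun q => hμ _) (fun q => hμM _) (fun q => B q.castSucc) (fun q => hB _)
      hind' i (fun q => htn _)
    have hmom := lintegral_normRow_rpow_le (P := P) hs1 hM p (fun q => n q.castSucc)
      (fun q => hn _) (fun q => μ q.castSucc) (fun q => h0 _)
      (fun q => hμ _) (fun q => hμM _) (fun q => B q.castSucc) (fun q => hB _) hind' i
    have hXB := (hind.indepFun_castSucc_last fun q => (hB q).measurable).comp
      (measurable_normRow p (fun q => n q.castSucc) i) measurable_id
    have hX := (measurable_normRow p (fun q => n q.castSucc) i).comp
      (measurable_pi_lambda (fun ω (q : Fin p) => B q.castSucc ω) fun q => (hB _).measurable)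
    have hstep := (hB (Fin.last p)).lintegral_mean_sq_sub_rpow_le hX hXB (hn _) hs (hμ _) (hμM _)
      (h0 _) (h1 _)
    set R := fun ω => ∑ k, normRow p (fun q => n q.castSucc) (fun q => B q.castSucc ω) i k ^ 2
    set Z := fun ω => ∑ k, normRow (p + 1) n (fun q => B q ω) i k ^ 2
    -- `Z - 1 = (Z - R) + (R - 1)`, where `R` omits the last factor: the first term is the error of
    -- one multiplication, weighted by the moment bound on `R`, and the second is the induction
    -- hypothesis.
    have hZ : ∫⁻ ω, ENNReal.ofReal (|Z ω - R ω| ^ s) ∂P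
        ≤ ENNReal.ofReal (rowDeviationConst s M * rowMomentConst s M ^ p * t ^ (-(s / 2))) := by
      simp only [Z, sum_normRow_succ_sq]
      refine (hstep.trans (mul_le_mul_right hmom _)).trans ?_
      rw [← ENNReal.ofReal_mul (by positivity)]
      refine ENNReal.ofReal_le_ofReal ?_
      have : (n (Fin.last p).succ : ℝ) ^ (-(s / 2)) ≤ t ^ (-(s / 2)) :=
        Real.rpow_le_rpow_of_nonpos ht (htn _) (by linarith)
      calc _ ≤ rowDeviationConst s M * t ^ (-(s / 2)) * rowMomentConst s M ^ p := by gcongr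
        _ = _ := by ring
    have hK := normRowConst_nonneg hs1 hM p
    have hRm : Measurable R := by
      have : ∀ k, Measurable fun ω =>
          normRow p (fun q => n q.castSucc) (fun q => B q.castSucc ω) i k := fun k =>
        (measurable_pi_apply k).comp hX
      fun_prop
    calc ∫⁻ ω, ENNReal.ofReal (|Z ω - 1| ^ s) ∂P
        ≤ ∫⁻ ω, ENNReal.ofReal (2 ^ s * (|Z ω - R ω| ^ s + |R ω - 1| ^ s)) ∂P := by
          refine lintegral_mono fun ω => ENNReal.ofReal_le_ofReal ?_
          simpa using abs_add_rpow_le_two_rpow hs1 (Z ω - R ω) (R ω - 1)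
      _ = ENNReal.ofReal (2 ^ s) * (∫⁻ ω, ENNReal.ofReal (|Z ω - R ω| ^ s) ∂P
            + ∫⁻ ω, ENNReal.ofReal (|R ω - 1| ^ s) ∂P) := by
          rw [lintegral_ofReal_const_mul (by positivity), ← lintegral_add_right _ (by fun_prop)]
          simp_rw [ENNReal.ofReal_add (Real.rpow_nonneg (abs_nonneg _) _)
            (Real.rpow_nonneg (abs_nonneg _) _)]
      _ ≤ ENNReal.ofReal (2 ^ s) *
            (ENNReal.ofReal (rowDeviationConst s M * rowMomentConst s M ^ p * t ^ (-(s / 2)))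
              + ENNReal.ofReal (normRowConst s M p * t ^ (-(s / 2)))) := by
          gcongr
      _ = _ := by
          rw [← ENNReal.ofReal_add (by positivity) (by positivity),
            ← ENNReal.ofReal_mul (by positivity)]
          congr 1
          rw [normRowConst]; ring

end NormRow

/-! ### The conditional mean as a function of the weights -/

section AbsMean

variable {μ : Measure ℝ}

lemma integral_abs_weightedSumLaw {n : ℕ} (x : Fin n → ℝ) :
    ∫ y, |y| ∂(weightedSumLaw μ x) = ∫ a, |∑ j, x j * a j| ∂(Measure.pi fun _ : Fin n => μ) := by
  rw [weightedSumLaw, integral_map (Measurable.aemeasurable (by fun_prop)) (by fun_prop)]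

lemma integral_abs_weightedSumLaw_mul {n : ℕ} {c : ℝ} (hc : 0 ≤ c) (x : Fin n → ℝ) :
    ∫ y, |y| ∂(weightedSumLaw μ fun j => c * x j) = c * ∫ y, |y| ∂(weightedSumLaw μ x) := by
  simp_rw [integral_abs_weightedSumLaw, mul_assoc, ← Finset.mul_sum, abs_mul, abs_of_nonneg hc]
  rw [integral_const_mul]

variable [IsProbabilityMeasure μ]

lemma measurable_integral_abs_weightedSumLaw (n : ℕ) :
    Measurable fun x : Fin n → ℝ => ∫ y, |y| ∂(weightedSumLaw μ x) := by
  simp_rw [integral_abs_weightedSumLaw]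
  have h : Measurable fun z : (Fin n → ℝ) × (Fin n → ℝ) => |∑ j, z.1 j * z.2 j| := by fun_prop
  exact (h.stronglyMeasurable.integral_prod_right' (ν := Measure.pi fun _ : Fin n => μ)).measurable

/-- The first absolute moment of a weighted sum with small weights of total square about `1` is
close to that of a standard Gaussian variable. -/
theorem exists_abs_integral_abs_weightedSumLaw_sub_le_of_near (h0 : ∫ y, y ∂μ = 0)
    (h1 : ∫ y : ℝ, y ^ 2 ∂μ = 1) {ε : ℝ} (hε : 0 < ε) :
    ∃ δ > 0, ∃ η > 0, ∀ (n : ℕ) (x : Fin n → ℝ), |∑ j, x j ^ 2 - 1| ≤ δ → (∀ j, |x j| ≤ η) →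
      |∫ y, |y| ∂(weightedSumLaw μ x) - √(2 / Real.pi)| ≤ ε := by
  obtain ⟨η, hη, h⟩ := exists_abs_integral_abs_weightedSumLaw_sub_le h0 h1
    (by positivity : 0 < ε / 4)
  -- The weights are rescaled by `√V`, which lies in `[1/2, 2]`: `η / 2` becomes at most `η`, and
  -- the total error is at most `2 * (ε / 4) + ε / 4`.
  refine ⟨min (1 / 2) (ε / 4), by positivity, η / 2, by positivity, fun n x hx hxη => ?_⟩
  have hx1 := hx.trans (min_le_left _ _)
  have hx2 := hx.trans (min_le_right _ _)
  set V := ∑ j, x j ^ 2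
  have hV := abs_le.1 hx1
  have hR2 : √V ^ 2 = V := Real.sq_sqrt (by linarith)
  have hR0 : 0 ≤ √V := Real.sqrt_nonneg V
  have hRl : 1 / 2 ≤ √V := by nlinarith
  have hRu : √V ≤ 2 := by nlinarith
  have hR1 : |√V - 1| ≤ ε / 4 := by
    calc |√V - 1| ≤ |√V - 1| * (√V + 1) := by
          have := abs_nonneg (√V - 1); nlinarith
      _ = |V - 1| := by
          rw [← abs_of_nonneg (by linarith : 0 ≤ √V + 1), ← abs_mul]
          congr 1; linear_combination hR2
      _ ≤ _ := hx2
  have hc1 : √(2 / Real.pi) ≤ 1 := by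
    exact Real.sqrt_le_one.2 ((div_le_one Real.pi_pos).2 Real.two_le_pi)
  have hpos : 0 < √V := by linarith
  have hn := h n (fun j => x j / √V)
    (by simp_rw [div_pow]; rw [← Finset.sum_div, hR2, div_self (by linarith)])
    (fun j => by
      rw [abs_div, abs_of_pos hpos, div_le_iff₀ hpos]
      have := hxη j
      nlinarith)
  have e : ∫ y, |y| ∂(weightedSumLaw μ x)
      = √V * ∫ y, |y| ∂(weightedSumLaw μ fun j => x j / √V) := by
    rw [← integral_abs_weightedSumLaw_mul hR0]
    congr 2
    ext j
    field_simp
  rw [e]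
  set I := ∫ y, |y| ∂(weightedSumLaw μ fun j => x j / √V)
  calc |√V * I - √(2 / Real.pi)| = |√V * (I - √(2 / Real.pi)) + √(2 / Real.pi) * (√V - 1)| := by
        congr 1; ring
    _ ≤ √V * |I - √(2 / Real.pi)| + √(2 / Real.pi) * |√V - 1| := by
        refine (abs_add_le _ _).trans ?_
        rw [abs_mul, abs_mul, abs_of_nonneg hR0, abs_of_nonneg (Real.sqrt_nonneg (2 / Real.pi))]
    _ ≤ 2 * (ε / 4) + 1 * (ε / 4) := by gcongr
    _ ≤ ε := by linarith

end AbsMean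

/-! ### Fluctuation of the row average around its conditional mean -/

section Deviation

variable {Ω : Type*} [MeasurableSpace Ω] {P : Measure Ω}

lemma measure_le_abs_le {f : Ω → ℝ} (hf : Measurable f) {δ r : ℝ} (hδ : 0 < δ) (hr : 0 ≤ r) :
    P {ω | δ ≤ |f ω|} ≤ ENNReal.ofReal (δ ^ (-r)) * ∫⁻ ω, ENNReal.ofReal (|f ω| ^ r) ∂P := by
  have h := mul_meas_ge_le_lintegral (μ := P) (f := fun ω => ENNReal.ofReal (|f ω| ^ r))
    (by fun_prop) (ENNReal.ofReal (δ ^ r))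
  have hsub : {ω | δ ≤ |f ω|} ⊆ {ω | ENNReal.ofReal (δ ^ r) ≤ ENNReal.ofReal (|f ω| ^ r)} :=
    fun ω hω => ENNReal.ofReal_le_ofReal (Real.rpow_le_rpow hδ.le hω hr)
  calc P {ω | δ ≤ |f ω|}
      = ENNReal.ofReal (δ ^ (-r)) * (ENNReal.ofReal (δ ^ r) * P {ω | δ ≤ |f ω|}) := by
        rw [← mul_assoc, ← ENNReal.ofReal_mul (by positivity), ← Real.rpow_add hδ,
          neg_add_cancel, Real.rpow_zero, ENNReal.ofReal_one, one_mul]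
    _ ≤ _ := by
        gcongr
        exact (mul_le_mul_right (measure_mono hsub) _).trans h

variable [IsProbabilityMeasure P]

/-- The constant of `HasIIDColumns.lintegral_mean_abs_sub_rpow_le`. -/
noncomputable def absDeviationConst (s M : ℝ) : ℝ := momentConst s * (2 * 2 ^ s * (momentConst s * M))

lemma absDeviationConst_nonneg {s M : ℝ} (hs : 1 ≤ s) (hM : 0 ≤ M) :
    0 ≤ absDeviationConst s M := by
  have := one_le_momentConst hs
  unfold absDeviationConst; positivity

lemma HasIIDColumns.lintegral_mean_abs_sub_rpow_le {m n : ℕ} {B : Ω → Fin m → Fin n → ℝ}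
    {X : Ω → Fin m → ℝ} {μ : Measure ℝ} [IsProbabilityMeasure μ] {s : ℝ}
    (hB : HasIIDColumns B μ P) (hX : Measurable X)
    (hXB : IndepFun X B P) (hn : 0 < n) (hs : 2 ≤ s) (hμ : MemLp id (ENNReal.ofReal s) μ)
    (h0 : ∫ y, y ∂μ = 0) :
    ∫⁻ ω, ENNReal.ofReal (|(n : ℝ)⁻¹ * ∑ k, |∑ j, X ω j * B ω j k|
        - ∫ y, |y| ∂(weightedSumLaw μ (X ω))| ^ s) ∂P
      ≤ ENNReal.ofReal (absDeviationConst s (∫ y, |y| ^ s ∂μ) * (n : ℝ) ^ (-(s / 2))) *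
        ∫⁻ ω, ENNReal.ofReal (1 + (∑ j, X ω j ^ 2) ^ s) ∂P := by
  have hn' : (0 : ℝ) < n := by exact_mod_cast hn
  have hM0 : 0 ≤ ∫ y, |y| ^ s ∂μ := integral_nonneg fun y => by positivity
  have hD := absDeviationConst_nonneg (by linarith : 1 ≤ s) hM0
  have hK := one_le_momentConst (by linarith : 1 ≤ s)
  have hg : Measurable fun z : (Fin m → ℝ) × (Fin m → Fin n → ℝ) =>
      ∫ y, |y| ∂(weightedSumLaw μ z.1) :=
    (measurable_integral_abs_weightedSumLaw m).comp measurable_fst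
  rw [← lintegral_ofReal_const_mul (by positivity)]
  refine lintegral_le_of_indepFun hX hB.measurable hXB
    (f := fun x b => ENNReal.ofReal (|(n : ℝ)⁻¹ * ∑ k, |∑ j, x j * b j k|
      - ∫ y, |y| ∂(weightedSumLaw μ x)| ^ s))
    (g := fun x => ENNReal.ofReal (absDeviationConst s (∫ y, |y| ^ s ∂μ) * (n : ℝ) ^ (-(s / 2)) *
      (1 + (∑ j, x j ^ 2) ^ s))) (by unfold Function.uncurry; fun_prop) fun x => ?_
  have e : ∀ z w : ℝ, |(n : ℝ)⁻¹ * z - w| ^ s = (n : ℝ) ^ (-s) * |z - n * w| ^ s := fun z w => by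
    rw [show (n : ℝ)⁻¹ * z - w = (n : ℝ)⁻¹ * (z - n * w) by field_simp, abs_mul,
      Real.mul_rpow (abs_nonneg _) (abs_nonneg _), abs_of_pos (by positivity),
      Real.inv_rpow hn'.le, Real.rpow_neg hn'.le]
  simp_rw [e]
  rw [lintegral_ofReal_const_mul (by positivity)]
  refine (mul_le_mul_right (hB.lintegral_sum_abs_sub_le hs hμ h0 x) _).trans ?_
  rw [← ENNReal.ofReal_mul (by positivity)]
  refine ENNReal.ofReal_le_ofReal ?_
  have hV : 0 ≤ ∑ j, x j ^ 2 := Finset.sum_nonneg fun j _ => sq_nonneg _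
  -- This trades the power `s / 2` for the power `s`, which is the one controlled by
  -- `lintegral_normRow_rpow_le`.
  have hS : (∑ j, x j ^ 2) ^ (s / 2) ≤ 1 + (∑ j, x j ^ 2) ^ s := by
    rcases le_total (∑ j, x j ^ 2) 1 with h | h
    · have := Real.rpow_le_one hV h (by linarith : 0 ≤ s / 2)
      have := Real.rpow_nonneg hV s
      linarith
    · have := Real.rpow_le_rpow_of_exponent_le h (by linarith : s / 2 ≤ s)
      linarith
  have e2 : (n : ℝ) ^ (-(s / 2)) = (n : ℝ) ^ (-s) * (n : ℝ) ^ (s / 2) := by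
    rw [← Real.rpow_add hn']; congr 1; ring
  calc _ ≤ (n : ℝ) ^ (-s) * (momentConst s * (2 * 2 ^ s * (momentConst s * (∫ y, |y| ^ s ∂μ) *
          (1 + (∑ j, x j ^ 2) ^ s))) * (n : ℝ) ^ (s / 2)) := by gcongr
    _ = _ := by rw [e2, absDeviationConst]; ring

end Deviation

/-! ### Smallness of the entries of a row -/

section LargeEntries

variable {Ω : Type*} [MeasurableSpace Ω] {P : Measure Ω} [IsProbabilityMeasure P] {s M : ℝ}

/-- The entries of a normalized row of a nonempty product are small with high probability. -/
theorem measure_exists_le_abs_normRow_le (hs : 2 ≤ s) (hM : 0 ≤ M) (p : ℕ) (n : Fin (p + 2) → ℕ)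
    (hn : ∀ q, 0 < n q) (μ : Fin (p + 1) → Measure ℝ) [∀ q, IsProbabilityMeasure (μ q)]
    (h0 : ∀ q, ∫ y, y ∂(μ q) = 0) (hμ : ∀ q, MemLp id (ENNReal.ofReal (2 * s)) (μ q))
    (hμM : ∀ q, ∫ y, |y| ^ (2 * s) ∂(μ q) ≤ M)
    (B : (q : Fin (p + 1)) → Ω → Fin (n q.castSucc) → Fin (n q.succ) → ℝ)
    (hB : ∀ q, HasIIDColumns (B q) (μ q) P) (hind : iIndepFun B P) (i : Fin (n 0))
    {t η : ℝ} (ht : 0 < t) (htn : ∀ q, t ≤ n q) (hη : 0 < η) :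
    P {ω | ∃ k, η ≤ |normRow (p + 1) n (fun q => B q ω) i k|}
      ≤ ENNReal.ofReal (η ^ (-(2 * s)) * rowMomentConst s M ^ (p + 1) * t ^ (-(s / 2))) := by
  have hs1 : 1 ≤ s := by linarith
  have hC := rowMomentConst_nonneg hs1 hM
  set N := n (Fin.last (p + 1))
  have hN0 : (0 : ℝ) < N := by exact_mod_cast hn _
  have hN1 : (1 : ℝ) ≤ N := by exact_mod_cast hn _
  have hmom := lintegral_normRow_rpow_le (P := P) hs1 hM p (fun q => n q.castSucc)
    (fun q => hn _) (fun q => μ q.castSucc) (fun q => h0 _)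
    (fun q => hμ _) (fun q => hμM _) (fun q => B q.castSucc) (fun q => hB _)
    (hind.precomp (Fin.castSucc_injective p)) i
  have hXB := (hind.indepFun_castSucc_last fun q => (hB q).measurable).comp
    (measurable_normRow p (fun q => n q.castSucc) i) measurable_id
  have hX := (measurable_normRow p (fun q => n q.castSucc) i).comp
    (measurable_pi_lambda (fun ω (q : Fin p) => B q.castSucc ω) fun q => (hB _).measurable)
  have hY := (measurable_normRow (p + 1) n i).comp
    (measurable_pi_lambda (fun ω (q : Fin (p + 1)) => B q ω) fun q => (hB _).measurable)
  have hk : ∀ k, P {ω | η ≤ |normRow (p + 1) n (fun q => B q ω) i k|}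
      ≤ ENNReal.ofReal (η ^ (-(2 * s)) * ((N : ℝ) ^ (-s) * rowMomentConst s M ^ (p + 1))) := by
    intro k
    refine (measure_le_abs_le ((measurable_pi_apply k).comp hY) hη
      (by linarith : 0 ≤ 2 * s)).trans ?_
    rw [ENNReal.ofReal_mul (by positivity : 0 ≤ η ^ (-(2 * s)))]
    gcongr
    have e : ∀ ω, |normRow (p + 1) n (fun q => B q ω) i k| ^ (2 * s) = (N : ℝ) ^ (-s) *
        |∑ j, normRow p (fun q => n q.castSucc) (fun q => B q.castSucc ω) i j
          * B (Fin.last p) ω j k| ^ (2 * s) := fun ω => by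
      rw [normRow_succ, abs_mul, Real.mul_rpow (abs_nonneg _) (abs_nonneg _), abs_inv,
        abs_of_nonneg (Real.sqrt_nonneg _), Real.sqrt_eq_rpow, ← Real.rpow_neg hN0.le,
        ← Real.rpow_mul hN0.le]
      congr 2; ring
    calc _ = ∫⁻ ω, ENNReal.ofReal ((N : ℝ) ^ (-s) *
          |∑ j, normRow p (fun q => n q.castSucc) (fun q => B q.castSucc ω) i j
          * B (Fin.last p) ω j k| ^ (2 * s)) ∂P := lintegral_congr fun ω => by
            rw [← e]; rfl
      _ ≤ ENNReal.ofReal ((N : ℝ) ^ (-s)) * (ENNReal.ofReal (rowMomentConst s M) *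
            ENNReal.ofReal (rowMomentConst s M ^ p)) := by
          rw [lintegral_ofReal_const_mul (by positivity)]
          gcongr
          exact ((hB (Fin.last p)).lintegral_entry_rpow_le hX hXB hs1 (hμ _) (hμM _)
            (h0 _) k).trans (mul_le_mul_right hmom _)
      _ = _ := by
          rw [← ENNReal.ofReal_mul hC, ← ENNReal.ofReal_mul (by positivity), ← pow_succ']
  rw [show {ω | ∃ k, η ≤ |normRow (p + 1) n (fun q => B q ω) i k|}
    = ⋃ k, {ω | η ≤ |normRow (p + 1) n (fun q => B q ω) i k|} by ext; simp]
  refine (measure_iUnion_fintype_le P _).trans ((Finset.sum_le_sum fun k _ => hk k).trans ?_)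
  rw [Finset.sum_const, Finset.card_univ, Fintype.card_fin, nsmul_eq_mul,
    ← ENNReal.ofReal_natCast, ← ENNReal.ofReal_mul (by positivity)]
  refine ENNReal.ofReal_le_ofReal ?_
  -- Each entry has a `2 * s`-th moment of order `N ^ (-s)` and the union over entries costs `N`; `1
  -- - s ≤ -(s / 2)` because `s ≥ 2`.
  have h1 : (N : ℝ) * (N : ℝ) ^ (-s) ≤ t ^ (-(s / 2)) := by
    calc (N : ℝ) * (N : ℝ) ^ (-s) = (N : ℝ) ^ (-s + 1) := by
          rw [Real.rpow_add_one hN0.ne', mul_comm]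
      _ ≤ (N : ℝ) ^ (-(s / 2)) := Real.rpow_le_rpow_of_exponent_le hN1 (by linarith)
      _ ≤ _ := Real.rpow_le_rpow_of_nonpos ht (htn _) (by linarith)
  calc _ = η ^ (-(2 * s)) * rowMomentConst s M ^ (p + 1) * ((N : ℝ) * (N : ℝ) ^ (-s)) := by ring
    _ ≤ _ := by gcongr

end LargeEntries

-- Deviation of a single row

universe u

/-- The normalized `ℓ¹` norm of a fixed row of a product of random matrices is close to `√(2 / π)`,
with a probability that allows for a union bound over the rows. -/
theorem exists_measure_row_deviation_le {s : ℝ} (hs : 2 ≤ s) (p : ℕ) (μ : Fin (p + 2) → Measure ℝ)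
    [∀ q, IsProbabilityMeasure (μ q)] (h0 : ∀ q, ∫ y, y ∂(μ q) = 0)
    (h1 : ∀ q, ∫ y : ℝ, y ^ 2 ∂(μ q) = 1)
    (hμ : ∀ q : Fin (p + 1), MemLp id (ENNReal.ofReal (2 * s)) (μ q.castSucc))
    (hμl : MemLp id (ENNReal.ofReal s) (μ (Fin.last (p + 1)))) {ε : ℝ} (hε : 0 < ε) :
    ∃ K ≥ 0, ∀ (n : Fin (p + 3) → ℕ) (_ : ∀ q, 0 < n q) (Ω : Type u) [MeasurableSpace Ω]
      (P : Measure Ω) [IsProbabilityMeasure P]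
      (B : (q : Fin (p + 2)) → Ω → Fin (n q.castSucc) → Fin (n q.succ) → ℝ)
      (_ : ∀ q, HasIIDColumns (B q) (μ q) P) (_ : iIndepFun B P) (i : Fin (n 0))
      (t : ℝ) (_ : 0 < t) (_ : ∀ q, t ≤ n q),
      P {ω | ε ≤ |(n (Fin.last (p + 2)) : ℝ)⁻¹ * ∑ k, |∑ j,
          normRow (p + 1) (fun q => n q.castSucc) (fun q => B q.castSucc ω) i j
            * B (Fin.last (p + 1)) ω j k| - √(2 / Real.pi)|}
        ≤ ENNReal.ofReal (K * t ^ (-(s / 2))) := by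
  have hs1 : 1 ≤ s := by linarith
  obtain ⟨δ, hδ, η, hη, hclt⟩ := exists_abs_integral_abs_weightedSumLaw_sub_le_of_near
    (h0 (Fin.last (p + 1))) (h1 _) (by positivity : 0 < ε / 2)
  have hMq : ∀ q : Fin (p + 1), 0 ≤ ∫ y, |y| ^ (2 * s) ∂(μ q.castSucc) := fun q =>
    integral_nonneg fun y => by positivity
  set M := ∑ q : Fin (p + 1), ∫ y, |y| ^ (2 * s) ∂(μ q.castSucc)
  have hM0 : 0 ≤ M := Finset.sum_nonneg fun q _ => hMq q
  have hμM : ∀ q : Fin (p + 1), ∫ y, |y| ^ (2 * s) ∂(μ q.castSucc) ≤ M := fun q =>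
    Finset.single_le_sum (f := fun q : Fin (p + 1) => ∫ y, |y| ^ (2 * s) ∂(μ q.castSucc))
      (fun q _ => hMq q) (Finset.mem_univ q)
  set L := ∫ y, |y| ^ s ∂(μ (Fin.last (p + 1)))
  have hL0 : 0 ≤ L := integral_nonneg fun y => by positivity
  have hC := rowMomentConst_nonneg hs1 hM0
  have hA := absDeviationConst_nonneg hs1 hL0
  have hR := normRowConst_nonneg hs1 hM0 (p + 1)
  -- One summand per bad event: the average strays from its conditional mean, the squared norm
  -- strays from `1`, some entry is large.
  refine ⟨(ε / 2) ^ (-s) * (absDeviationConst s L * (1 + rowMomentConst s M ^ (p + 1)))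
    + δ ^ (-s) * normRowConst s M (p + 1) + η ^ (-(2 * s)) * rowMomentConst s M ^ (p + 1),
    by positivity, ?_⟩
  intro n hn Ω _ P _ B hB hind i t ht htn
  have hind' := hind.precomp (Fin.castSucc_injective (p + 1))
  have hXB := (hind.indepFun_castSucc_last fun q => (hB q).measurable).comp
    (measurable_normRow (p + 1) (fun q => n q.castSucc) i) measurable_id
  have hX := (measurable_normRow (p + 1) (fun q => n q.castSucc) i).comp
    (measurable_pi_lambda (fun ω (q : Fin (p + 1)) => B q.castSucc ω) fun q => (hB _).measurable)
  have hmom := lintegral_normRow_rpow_le (P := P) hs1 hM0 (p + 1) (fun q => n q.castSucc)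
    (fun q => hn _) (fun q => μ q.castSucc) (fun q => h0 _)
    hμ hμM (fun q => B q.castSucc) (fun q => hB _) hind' i
  have hdev := lintegral_normRow_deviation_le (P := P) hs hM0 (p + 1) (fun q => n q.castSucc)
    (fun q => hn _) (fun q => μ q.castSucc) (fun q => h0 _) (fun q => h1 _)
    hμ hμM (fun q => B q.castSucc) (fun q => hB _) hind' i ht (fun q => htn _)
  have hent := measure_exists_le_abs_normRow_le (P := P) hs hM0 p (fun q => n q.castSucc)
    (fun q => hn _) (fun q => μ q.castSucc) (fun q => h0 _)
    hμ hμM (fun q => B q.castSucc) (fun q => hB _) hind' i ht (fun q => htn _) hη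
  have habs := (hB (Fin.last (p + 1))).lintegral_mean_abs_sub_rpow_le hX hXB (hn _) hs hμl (h0 _)
  set X := fun ω => normRow (p + 1) (fun q => n q.castSucc) (fun q => B q.castSucc ω) i
  have hXm : Measurable X := hX
  have hXj : ∀ j, Measurable fun ω => X ω j := fun j => (measurable_pi_apply j).comp hXm
  have hBm := (hB (Fin.last (p + 1))).measurable_entry
  set g := fun ω => ∫ y, |y| ∂(weightedSumLaw (μ (Fin.last (p + 1))) (X ω))
  have hgm : Measurable g := (measurable_integral_abs_weightedSumLaw _).comp hXm
  set S := fun ω => (n (Fin.last (p + 2)) : ℝ)⁻¹ * ∑ k, |∑ j, X ω j * B (Fin.last (p + 1)) ω j k|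
  have hSm : Measurable S := by fun_prop
  -- Off the last two events, the realized row `X ω` is an admissible weight vector for the central
  -- limit theorem, applied pointwise in `ω`.
  have hsub : {ω | ε ≤ |S ω - √(2 / Real.pi)|} ⊆ ({ω | ε / 2 ≤ |S ω - g ω|} ∪
      {ω | δ ≤ |∑ k, X ω k ^ 2 - 1|}) ∪ {ω | ∃ k, η ≤ |X ω k|} := by
    intro ω hω
    by_contra hcon
    simp only [Set.mem_union, Set.mem_ofPred_eq, not_or, not_le, not_exists] at hcon hω
    have h3 := hclt _ (X ω) hcon.1.2.le fun j => (hcon.2 j).le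
    have h4 := abs_sub_le (S ω) (g ω) (√(2 / Real.pi))
    linarith [hcon.1.1]
  have b1 : P {ω | ε / 2 ≤ |S ω - g ω|} ≤ ENNReal.ofReal ((ε / 2) ^ (-s) *
      (absDeviationConst s L * (1 + rowMomentConst s M ^ (p + 1))) * t ^ (-(s / 2))) := by
    refine (measure_le_abs_le (hSm.sub hgm) (by positivity) (by linarith : 0 ≤ s)).trans ?_
    have h2 : ∫⁻ ω, ENNReal.ofReal (1 + (∑ j, X ω j ^ 2) ^ s) ∂P
        ≤ ENNReal.ofReal (1 + rowMomentConst s M ^ (p + 1)) := by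
      simp_rw [ENNReal.ofReal_add zero_le_one
        (Real.rpow_nonneg (Finset.sum_nonneg fun j _ => sq_nonneg (X _ j)) s)]
      rw [lintegral_add_left measurable_const, ENNReal.ofReal_add zero_le_one (by positivity)]
      gcongr
      simp
    have ht' : (n (Fin.last (p + 2)) : ℝ) ^ (-(s / 2)) ≤ t ^ (-(s / 2)) :=
      Real.rpow_le_rpow_of_nonpos ht (htn _) (by linarith)
    calc _ ≤ ENNReal.ofReal ((ε / 2) ^ (-s)) * (ENNReal.ofReal (absDeviationConst s L
          * (n (Fin.last (p + 2)) : ℝ) ^ (-(s / 2))) *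
          ENNReal.ofReal (1 + rowMomentConst s M ^ (p + 1))) :=
          mul_le_mul_right (habs.trans (mul_le_mul_right h2 _)) _
      _ ≤ _ := by
          rw [← ENNReal.ofReal_mul (by positivity), ← ENNReal.ofReal_mul (by positivity)]
          refine ENNReal.ofReal_le_ofReal ?_
          calc _ ≤ (ε / 2) ^ (-s) * (absDeviationConst s L * t ^ (-(s / 2)) *
                (1 + rowMomentConst s M ^ (p + 1))) := by gcongr
            _ = _ := by ring
  have b2 : P {ω | δ ≤ |∑ k, X ω k ^ 2 - 1|}
      ≤ ENNReal.ofReal (δ ^ (-s) * normRowConst s M (p + 1) * t ^ (-(s / 2))) := by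
    refine (measure_le_abs_le (by fun_prop) hδ (by linarith : 0 ≤ s)).trans ?_
    rw [mul_assoc, ENNReal.ofReal_mul (by positivity)]
    exact mul_le_mul_right hdev _
  refine (measure_mono hsub).trans ((measure_union_le _ _).trans
    ((add_le_add ((measure_union_le _ _).trans (add_le_add b1 b2)) hent).trans_eq ?_))
  rw [← ENNReal.ofReal_add (by positivity) (by positivity),
    ← ENNReal.ofReal_add (by positivity) (by positivity)]
  congr 1
  ring

/-! ### From rows to the operator norm, and the union bound -/

section OperatorNorm

/-- The norm is a maximum of row sums, attained since there is a row. Attainment is what lets one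
union bound handle both upper and lower deviations. -/
lemma exists_linftyOpNorm_eq {m n : ℕ} (hm : 0 < m) (A : Matrix (Fin m) (Fin n) ℝ) :
    ∃ i, linftyOpNorm A = ∑ j, |A i j| := by
  let _ : NormedAddCommGroup (Matrix (Fin m) (Fin n) ℝ) := Matrix.linftyOpNormedAddCommGroup
  have h : linftyOpNorm A = ‖A‖ := (Matrix.linfty_opNorm_eq_opNorm A).symm
  have : Nonempty (Fin m) := ⟨⟨0, hm⟩⟩
  obtain ⟨i, -, hi⟩ := Finset.exists_mem_eq_sup (Finset.univ : Finset (Fin m))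
    Finset.univ_nonempty fun i => ∑ j, ‖A i j‖₊
  refine ⟨i, ?_⟩
  rw [h, Matrix.linfty_opNorm_def, hi]
  simp

end OperatorNorm

lemma prod_Ioo_zero_last (p : ℕ) (f : Fin (p + 2) → ℝ) :
    ∏ q ∈ Finset.Ioo 0 (Fin.last (p + 1)), f q = ∏ q : Fin p, f q.succ.castSucc := by
  rw [← Finset.prod_image (s := Finset.univ) (g := fun q : Fin p => q.succ.castSucc) (f := f)
    (fun a _ b _ h => by simpa using h)]
  congr 1
  ext q
  simp only [Finset.mem_Ioo, Finset.mem_image, Finset.mem_univ, true_and]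
  constructor
  · rintro ⟨h1, h2⟩
    have h1' : q ≠ 0 := h1.ne'
    have h2' : (q : ℕ) < p + 1 := h2
    have h3 : (q : ℕ) ≠ 0 := fun h => h1' (Fin.ext h)
    exact ⟨⟨q - 1, by omega⟩, Fin.ext (by simp; omega)⟩
  · rintro ⟨a, rfl⟩
    exact ⟨by simp [Fin.lt_def], Fin.castSucc_lt_last _⟩

/-- Independent identically distributed entries give independent iid matrices. -/
lemma hasIIDColumns_of_iIndepFun {Ω : Type*} [MeasurableSpace Ω] {P : Measure Ω} {p : ℕ}
    {n : Fin (p + 1) → ℕ} {μ : Fin p → Measure ℝ}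
    {A : (q : Fin p) → Ω → Fin (n q.castSucc) → Fin (n q.succ) → ℝ}
    (hA : ∀ q i j, Measurable fun ω => A q ω i j)
    (hlaw : ∀ q i j, P.map (fun ω => A q ω i j) = μ q)
    (hind : iIndepFun (fun (e : Σ q : Fin p, Fin (n q.castSucc) × Fin (n q.succ)) ω =>
      A e.1 ω e.2.1 e.2.2) P) :
    (∀ q, HasIIDColumns (A q) (μ q) P) ∧ iIndepFun A P := by
  have h1 := hind.sigma_curry fun e => hA e.1 e.2.1 e.2.2
  refine ⟨fun q => ⟨?_, ?_, fun k => ?_⟩, ?_⟩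
  · exact measurable_pi_lambda _ fun i => measurable_pi_lambda _ fun j => hA q i j
  -- The column index is put first, so that currying groups the entries by columns.
  · have h2 := hind.precomp
      (g := fun e : (Σ _ : Fin (n q.succ), Fin (n q.castSucc)) =>
        (⟨q, e.2, e.1⟩ : Σ q : Fin p, Fin (n q.castSucc) × Fin (n q.succ)))
      (fun a b h => by
        obtain ⟨a1, a2⟩ := a
        obtain ⟨b1, b2⟩ := b
        simp only [Sigma.mk.injEq, heq_eq_eq, Prod.mk.injEq, true_and] at h
        simp [h.1, h.2])
    exact h2.sigma_curry fun e => hA q e.2 e.1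
  · have h2 := hind.precomp
      (g := fun i : Fin (n q.castSucc) =>
        (⟨q, i, k⟩ : Σ q : Fin p, Fin (n q.castSucc) × Fin (n q.succ)))
      (fun a b h => by simpa using h)
    have h3 := h2.map_fun_eq_pi_map fun i => (hA q i k).aemeasurable
    refine h3.trans ?_
    simp [hlaw]
  · exact h1.comp (fun q f i j => f (i, j)) fun q => by fun_prop

theorem theorem1p2 (α : ℝ) (hα : 1 < α) (p : ℕ) (hp : 2 ≤ p)
    -- the law of the entries of the matrix number `q + 1`, fixed as the dimensions vary
    (μ : Fin p → Measure ℝ) [∀ q, IsProbabilityMeasure (μ q)]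
    (hmean : ∀ q, ∫ x, x ∂(μ q) = 0)
    (hvar : ∀ q, variance id (μ q) = 1)
    (hmom : ∀ q : Fin p, (q : ℕ) + 1 < p → MemLp id (ENNReal.ofReal (4 * α)) (μ q))
    (hmom_last : ∀ q : Fin p, (q : ℕ) + 1 = p → MemLp id (ENNReal.ofReal (2 * α)) (μ q))
    {Ω : (Fin (p + 1) → ℕ) → Type*} [∀ n, MeasurableSpace (Ω n)]
    (P : ∀ n, Measure (Ω n)) [∀ n, IsProbabilityMeasure (P n)]
    (A : ∀ (n : Fin (p + 1) → ℕ) (q : Fin p),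
      Ω n → Matrix (Fin (n q.castSucc)) (Fin (n q.succ)) ℝ)
    (hlaw : ∀ n, (∀ q, 0 < n q) → ∀ q i j, HasLaw (fun ω => A n q ω i j) (μ q) (P n))
    -- all the entries of all the matrices are jointly independent
    (hindep : ∀ n, (∀ q, 0 < n q) →
      iIndepFun (fun (e : Σ q : Fin p, Fin (n q.castSucc) × Fin (n q.succ)) ω =>
        A n e.1 ω e.2.1 e.2.2) (P n)) :
    TendstoInProbComparable P
      (fun n ω => (n (Fin.last p) : ℝ)⁻¹ *
        (∏ q ∈ Finset.Ioo 0 (Fin.last p), (n q : ℝ)) ^ (-(1 / 2) : ℝ) *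
        linftyOpNorm (chainProd p n (fun q => A n q ω)))
      (fun _ _ => Real.sqrt (2 / Real.pi)) := by
  -- With `p + 2` factors, the `p + 1` factors before the last form a nonempty product. This
  -- matters: a row of the empty product is a unit basis vector, whose entries are not small.
  obtain ⟨p, rfl⟩ := Nat.exists_eq_add_of_le' hp
  intro C ε δ hε hδ
  have h1 : ∀ q, ∫ y : ℝ, y ^ 2 ∂(μ q) = 1 := fun q => by
    have h := hvar q
    rw [variance_eq_integral aemeasurable_id] at h
    simpa [hmean q] using h
  obtain ⟨K, hK, hrow⟩ := exists_measure_row_deviation_le (s := 2 * α) (by linarith) p μ hmean h1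
    (fun q => by
      rw [show 2 * (2 * α) = 4 * α by ring]
      exact hmom _ (by have := q.2; simp; omega))
    (hmom_last _ (by simp)) hε
  -- This is the union bound `n 0 * K * (n 0 / C) ^ (-α)` as a function of `n 0`. The absolute value
  -- is there because `C > 0` is known only once admissible dimensions are given.
  have hlim : Filter.Tendsto (fun N : ℕ => K * |C| ^ α * (N : ℝ) ^ (-(α - 1))) Filter.atTop
      (nhds 0) := by
    have := ((tendsto_rpow_neg_atTop (by linarith : 0 < α - 1)).comp
      tendsto_natCast_atTop_atTop).const_mul (K * |C| ^ α)
    simpa [Function.comp_def] using this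
  obtain ⟨N, hN⟩ := Filter.eventually_atTop.1
    ((hlim.eventually_le_const hδ).and (Filter.eventually_ge_atTop 1))
  refine ⟨N, fun n hn => ?_⟩
  have hN1 : 1 ≤ N := (hN N le_rfl).2
  have hpos : ∀ q, 0 < n q := fun q => by have := (hn q q).1; omega
  have hposR : ∀ q, (0 : ℝ) < n q := fun q => by exact_mod_cast hpos q
  have hC : 0 < C := by
    by_contra hC
    have := (hn 0 0).2
    have := hposR 0
    nlinarith
  have hAm := fun q i j => (hlaw n hpos q i j).aemeasurable
  -- The entries are only almost everywhere measurable; measurable versions keep their laws and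
  -- independence.
  set B : (q : Fin (p + 2)) → Ω n → Fin (n q.castSucc) → Fin (n q.succ) → ℝ :=
    fun q ω i j => (hAm q i j).mk _ ω
  have hAB : ∀ q i j, (fun ω => A n q ω i j) =ᵐ[P n] fun ω => B q ω i j := fun q i j =>
    (hAm q i j).ae_eq_mk
  obtain ⟨hB, hindB⟩ := hasIIDColumns_of_iIndepFun (P := P n) (A := B) (μ := μ)
    (fun q i j => (hAm q i j).measurable_mk)
    (fun q i j => (Measure.map_congr (hAB q i j)).symm.trans (hlaw n hpos q i j).map_eq)
    ((hindep n hpos).congr fun e => hAB e.1 e.2.1 e.2.2)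
  have hae : ∀ᵐ ω ∂(P n), ∀ q, A n q ω = B q ω := by
    rw [ae_all_iff]
    intro q
    have : ∀ᵐ ω ∂(P n), ∀ i j, A n q ω i j = B q ω i j :=
      ae_all_iff.2 fun i => ae_all_iff.2 fun j => hAB q i j
    filter_upwards [this] with ω hω
    ext i j
    exact hω i j
  set S : Fin (n 0) → Ω n → ℝ := fun i ω => (n (Fin.last (p + 2)) : ℝ)⁻¹ * ∑ k, |∑ j,
    normRow (p + 1) (fun q => n q.castSucc) (fun q => B q.castSucc ω) i j
      * B (Fin.last (p + 1)) ω j k| with hS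
  have hprob : P n {ω | ε ≤ |(n (Fin.last (p + 2)) : ℝ)⁻¹ *
        (∏ q ∈ Finset.Ioo 0 (Fin.last (p + 2)), (n q : ℝ)) ^ (-(1 / 2) : ℝ) *
        linftyOpNorm (chainProd (p + 2) n (fun q => A n q ω)) - √(2 / Real.pi)|}
      ≤ P n (⋃ i, {ω | ε ≤ |S i ω - √(2 / Real.pi)|}) := by
    refine measure_mono_ae ?_
    filter_upwards [hae] with ω hω h
    obtain ⟨i, hi⟩ := exists_linftyOpNorm_eq (hpos 0) (chainProd (p + 2) n (fun q => A n q ω))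
    refine Set.mem_iUnion.2 ⟨i, ?_⟩
    have hSi : S i ω = (n (Fin.last (p + 2)) : ℝ)⁻¹ *
        (∏ q ∈ Finset.Ioo 0 (Fin.last (p + 2)), (n q : ℝ)) ^ (-(1 / 2) : ℝ) *
        linftyOpNorm (chainProd (p + 2) n (fun q => A n q ω)) := by
      have hP0 : 0 ≤ ∏ q : Fin (p + 1), (n q.succ.castSucc : ℝ) :=
        Finset.prod_nonneg fun q _ => (hposR _).le
      rw [hi, prod_Ioo_zero_last (p + 1) fun q => (n q : ℝ), Real.rpow_neg hP0,
        ← Real.sqrt_eq_rpow, mul_assoc, Finset.mul_sum]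
      simp only [hS]
      congr 1
      refine Finset.sum_congr rfl fun k _ => ?_
      rw [← abs_of_nonneg (inv_nonneg.2 (Real.sqrt_nonneg
        (∏ q : Fin (p + 1), (n q.succ.castSucc : ℝ)))), ← abs_mul]
      have hA : (fun q => A n q ω) = fun q => B q ω := funext hω
      rw [hA]
      have e : chainProd (p + 2) n (fun q => B q ω) i k = ∑ j,
          chainProd (p + 1) (fun q => n q.castSucc) (fun q => B q.castSucc ω) i j
            * B (Fin.last (p + 1)) ω j k := rfl
      rw [e, Finset.mul_sum]
      congr 1
      refine Finset.sum_congr rfl fun j _ => ?_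
      simp only [normRow, mul_assoc]
    have h' : ε ≤ _ := h
    rw [← hSi] at h'
    exact h'
  -- `n 0 / C` serves as the common lower bound `t` for the dimensions, so that the row bound is
  -- expressed through the number `n 0` of rows.
  have ht : ∀ q, (n 0 : ℝ) / C ≤ n q := fun q => by
    rw [div_le_iff₀ hC, mul_comm]; exact (hn 0 q).2
  have ht0 : (0 : ℝ) < n 0 / C := div_pos (hposR 0) hC
  have hsum : P n (⋃ i, {ω | ε ≤ |S i ω - √(2 / Real.pi)|}) ≤ ENNReal.ofReal δ := by
    have hi : ∀ i, P n {ω | ε ≤ |S i ω - √(2 / Real.pi)|}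
        ≤ ENNReal.ofReal (K * (n 0 / C : ℝ) ^ (-(2 * α / 2))) := fun i =>
      hrow n hpos (Ω n) (P n) B hB hindB i _ ht0 ht
    refine (measure_iUnion_fintype_le _ _).trans ((Finset.sum_le_sum fun i _ => hi i).trans ?_)
    rw [Finset.sum_const, Finset.card_univ, Fintype.card_fin, nsmul_eq_mul,
      ← ENNReal.ofReal_natCast, ← ENNReal.ofReal_mul (by positivity)]
    refine ENNReal.ofReal_le_ofReal (le_trans (le_of_eq ?_) (hN (n 0) (hn 0 0).1).1)
    rw [abs_of_pos hC, mul_div_cancel_left₀ α two_ne_zero, Real.div_rpow (hposR 0).le hC.le,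
      Real.rpow_neg hC.le, show -(α - 1) = -α + 1 by ring, Real.rpow_add_one (hposR 0).ne',
      div_inv_eq_mul]
    ring
  exact ENNReal.toReal_le_of_le_ofReal hδ.le (hprob.trans hsum)
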